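/- For integers $N\ge 2$ and $1\le p\le\lfloor N/2\rfloor$ let $\mu^{(N,p)}$ be the maximum of $\frac{1}{N-1}\sum_{l=1}^{N-1}x_l$ over all $x\in\{0,1\}^{N-1}$ such that $x_l=x_{N-l}$ for all $1\le l\le N-1$ and $$\sum_{l=1}^{N-1}x_l\cos\Big(\frac{2\pi pl}{N}\Big)\Big[-1+\cos\Big(\frac{2\pi kl}{N}\Big)\Big]<0\qquad\text{for all }1\le k\le N-1,$$ whenever such an $x$ exists (otherwise $\mu^{(N,p)}$ is undefined); that is, $\mu^{(N,p)}$ is the maximal connectivity of a circulant network of $N$ identical phase oscillators whose $p$-twisted state $\theta_j=2\pi pj/N$ is linearly stable. Then the supremum $\overline\mu$ of all $\mu^{(N,p)}$ that are defined is $$\overline\mu=\frac{11}{19}-\frac{2}{19}\cdot\frac{\sum_{l=1}^{5}\left[-\cos\left(\frac{2\pi l}{19}\right)+\cos^{2}\left(\frac{2\pi l}{19}\right)\right]}{-\cos\left(\frac{12\pi}{19}\right)+\cos^{2}\left(\frac{12\pi}{19}\right)}=0.683875\cdots,$$ and $\mu^{(19m,m)}$ is defined for all $m\ge1$ and tends to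 $\overline\mu$ as $m\to\infty$. Consequently $\overline\mu$ is a lower bound on the critical connectivity. For a network (a simple graph on $N\ge 2$ nodes with adjacency matrix $(a_{ij})$), let its connectivity be its minimum degree divided by $N-1$, and consider $\dot\theta_i=\sum_{j}a_{ij}\sin(\theta_j-\theta_i)$. Call an equilibrium linearly stable if all eigenvalues of its Jacobian matrix are negative, except for one simple eigenvalue $0$ (with constant eigenvectors), and call the network globally synchronizing if, for Lebesgue-almost every initial condition, all phase differences tend to $0$ modulo $2\pi$ as $t\to\infty$. Let $\mu_{\mathrm c}$ be the infimum of all real $c$ such that every network with connectivity at least $c$ is globally synchronizing. Then for every $c<\overline\mu$ there is a network with connectivity greater than $c$ that has a linearly stable equilibrium whose phases are not all equal modulo $2\pi$, and $\mu_{\mathrm c}\ge\overline\mu$. -/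

import Mathlib

open Filter Topology MeasureTheory

/-! ### The integer program for twisted states of circulant networks -/

/-- The entry `(k, l)`, `1 ≤ k, l ≤ N - 1`, of the matrix `L^{(N,p)}`, for which `(L^{(N,p)} x)_k`
is the `k`-th Jacobian eigenvalue of the `p`-twisted state on the circulant network given by `x`. -/
noncomputable def twistedL (N p k l : ℕ) : ℝ :=
  Real.cos (2 * Real.pi * p * l / N) * (-1 + Real.cos (2 * Real.pi * k * l / N))

/-- `x = (x_1, …, x_{N-1})` is a feasible point of the integer program of `(N, p)`.
Only the values of `x` at the indices `1, …, N - 1` are ever used. -/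
structure IsFeasible (N p : ℕ) (x : ℕ → ℝ) : Prop where
  /-- `x ∈ {0,1}^{N-1}` -/
  binary : ∀ l ∈ Finset.Icc 1 (N - 1), x l = 0 ∨ x l = 1
  /-- `L^{(N,p)} x < 0` componentwise -/
  stable : ∀ k ∈ Finset.Icc 1 (N - 1), ∑ l ∈ Finset.Icc 1 (N - 1), twistedL N p k l * x l < 0
  /-- the network is undirected: `x_l = x_{N-l}` -/
  symm : ∀ l ∈ Finset.Icc 1 (N - 1), x l = x (N - l)

/-- The objective function of the integer program, i.e. the connectivity of the circulant
network given by `x`. -/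
noncomputable def circulantConnectivity (N : ℕ) (x : ℕ → ℝ) : ℝ :=
  (∑ l ∈ Finset.Icc 1 (N - 1), x l) / ((N : ℝ) - 1)

/-- `μ = μ^{(N,p)}`: the integer program of `(N, p)` is feasible and `μ` is its maximum value. -/
def IsMaxConnectivity (N p : ℕ) (μ : ℝ) : Prop :=
  IsGreatest {c : ℝ | ∃ x : ℕ → ℝ, IsFeasible N p x ∧ c = circulantConnectivity N x} μ

/-- The function `-cos θ + cos² θ` at `θ = 2πl/19`. -/
noncomputable def b19 (l : ℕ) : ℝ :=
  -Real.cos (2 * Real.pi * l / 19) + Real.cos (2 * Real.pi * l / 19) ^ 2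

/-- The closed form of the supremum (note that `12π/19 = 2π·6/19`). -/
noncomputable def supMu : ℝ :=
  11 / 19 - 2 / 19 * ((∑ l ∈ Finset.Icc 1 5, b19 l) / b19 6)

/-! ### Identical phase oscillators on networks and the critical connectivity -/

/-- The connectivity of a network on `N` nodes: minimum degree divided by `N - 1`. -/
noncomputable def connectivity {N : ℕ} (G : SimpleGraph (Fin N)) : ℝ :=
  open scoped Classical in (G.minDegree : ℝ) / ((N : ℝ) - 1)

/-- The vector field `θ ↦ (∑ⱼ aᵢⱼ sin(θⱼ - θᵢ))ᵢ` (phases lifted to `ℝ`). -/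
noncomputable def phaseField {N : ℕ} (G : SimpleGraph (Fin N)) (θ : Fin N → ℝ) (i : Fin N) : ℝ :=
  open scoped Classical in ∑ j, G.adjMatrix ℝ i j * Real.sin (θ j - θ i)

/-- `θ` solves the oscillator equations on the time interval `[0, ∞)`. -/
def IsSolution {N : ℕ} (G : SimpleGraph (Fin N)) (θ : ℝ → Fin N → ℝ) : Prop :=
  ∀ t : ℝ, 0 ≤ t → ∀ i, HasDerivWithinAt (fun s => θ s i) (phaseField G (θ t) i) (Set.Ici 0) t

/-- All oscillators have the same phase modulo `2π`. -/
def IsInPhase {N : ℕ} (θ : Fin N → ℝ) : Prop :=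
  ∀ i j, (θ i : Real.Angle) = (θ j : Real.Angle)

/-- The trajectory converges to in-phase synchronization: all phase differences tend to zero
modulo `2π`. -/
def ConvergesToInPhase {N : ℕ} (θ : ℝ → Fin N → ℝ) : Prop :=
  ∀ i j, Tendsto (fun t => ((θ t i - θ t j : ℝ) : Real.Angle)) atTop (𝓝 0)

/-- For almost every initial condition, the solution converges to in-phase synchronization. -/
def GloballySynchronizing {N : ℕ} (G : SimpleGraph (Fin N)) : Prop :=
  ∀ᵐ θ₀ : Fin N → ℝ, ∃ θ : ℝ → Fin N → ℝ,
    θ 0 = θ₀ ∧ IsSolution G θ ∧ ConvergesToInPhase θ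

/-- The critical connectivity: the smallest threshold (as an infimum) such that all networks
with connectivity at least that threshold are globally synchronizing. -/
noncomputable def criticalConnectivity : ℝ :=
  sInf {c : ℝ | ∀ N : ℕ, 2 ≤ N → ∀ G : SimpleGraph (Fin N),
    c ≤ connectivity G → GloballySynchronizing G}

/-- The Jacobian matrix of the vector field at `θ`. -/
noncomputable def phaseJacobian {N : ℕ} (G : SimpleGraph (Fin N)) (θ : Fin N → ℝ) :
    Matrix (Fin N) (Fin N) ℝ :=
  open scoped Classical in Matrix.of fun i j =>
    if i = j then -∑ k, G.adjMatrix ℝ i k * Real.cos (θ k - θ i)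
    else G.adjMatrix ℝ i j * Real.cos (θ j - θ i)

/-- `θ` is a linearly stable equilibrium: apart from the zero eigenvalue of the constant vectors
(rotational symmetry), all eigenvalues of the symmetric Jacobian matrix are negative. In
particular the eigenvalue zero is simple. -/
def IsLinearlyStableEquilibrium {N : ℕ} (G : SimpleGraph (Fin N)) (θ : Fin N → ℝ) : Prop :=
  (∀ i, phaseField G θ i = 0) ∧
  ∀ (lam : ℝ) (v : Fin N → ℝ), (phaseJacobian G θ).mulVec v = lam • v →
    (¬ ∃ c : ℝ, v = fun _ => c) → lam < 0

/-!
The condition with `k = p` says that `∑ x_l b(2πpl/N) < 0`, where `b = -cos + cos²`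
(`stabilityCost`). This single linear constraint turns the integer program into a knapsack problem.
By weak duality, `(∑ x_l + 1) / N` is at most the mean of `max 0 (1 - λ b)` over the `N` phases, for
every `λ ≥ 0`; here the `1` accounts for the phase `0`, whose cost is zero. With `g = gcd(N, p)` and
`n = N / g`, the phases run `g` times through the multiples of `2π/n`, so that only the mean over
`n` equidistant phases matters (`sum_add_one_le_gcd_mul_dualSum`). For `n = 19` the best multiplier
is `λ = 1 / b(12π/19)`, and the mean is exactly `supMu` (`dualSum_nineteen`). For other `n` it is
smaller: for `n ≤ 18` by a computation in rational arithmetic, where `n = 4` is excluded because all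
costs are nonnegative; for `n ≥ 20`, with `λ = 1.2`, because the positive terms form a partial sum
over `|j| ≤ J`, which is a combination of Dirichlet kernels in closed form, and this closed form can
be maximized over the real variable `(J + 1/2) 2π/n` (`dualSum_le_of_twenty_le`).

The bound is approached by the configurations `nearOptimal` for `N = 19m`, `p = m`: all indices in
the classes `0, ±1, …, ±5` modulo `19`, and just less than the critical fraction of the classes
`±6`. Only the frequencies `k = m` and `k = 18m` bind. For all others the condition holds even with
the full classes `±6`, where the sums are Dirichlet kernels again
(`nearOptimal_full_eigenvalue_neg`).

A feasible point is a circulant network whose twisted state is an equilibrium. The discrete Fourier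
transform diagonalizes the Jacobian, and its eigenvalues for `k ≠ 0` are the left-hand sides of the
stability conditions (`exists_network_of_isFeasible`). Finally, the oscillator equations are the
gradient flow of `phaseEnergy`. At a linearly stable equilibrium the Hessian is coercive modulo the
constant vectors, so that a neighbourhood of the equilibrium traps all solutions of low energy. If
the equilibrium is not in phase, an open set of initial conditions therefore does not synchronize
(`not_globallySynchronizing_of_isLinearlyStableEquilibrium`), which bounds the critical
connectivity from below.
-/

/-! ### Rational approximation of cosines -/

/-- The Taylor polynomial of `cos` of degree `22`, evaluated in the rationals. -/
def cosTaylor (x : ℚ) : ℚ := ∑ i ∈ Finset.range 12, (-1) ^ i * x ^ (2 * i) / (2 * i).factorial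

theorem abs_cos_sub_cosTaylor_le (x : ℚ) (hx : |x| ≤ 32 / 10) :
    |Real.cos x - cosTaylor x| ≤ 1 / 10 ^ 11 := by
  have hx' : |(x : ℝ)| ≤ 32 / 10 := by
    have := (Rat.cast_le (K := ℝ)).2 hx
    push_cast at this
    exact this
  have hn : ‖((x : ℝ) : ℂ) * Complex.I‖ = |(x : ℝ)| := by simp
  have h := Complex.exp_bound' (x := ((x : ℝ) : ℂ) * Complex.I) (n := 24) (by
    rw [hn]; push_cast; linarith)
  rw [hn] at h
  have h2 := (Complex.abs_re_le_norm _).trans h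
  rw [Complex.sub_re, Complex.exp_ofReal_mul_I_re] at h2
  have e : (∑ m ∈ Finset.range 24, (((x : ℝ) : ℂ) * Complex.I) ^ m / (m.factorial : ℂ)).re
      = cosTaylor x := by
    have key : ∀ k : ℕ, (∑ m ∈ Finset.range (2 * k),
        (((x : ℝ) : ℂ) * Complex.I) ^ m / (m.factorial : ℂ)).re
        = ∑ i ∈ Finset.range k, (-1) ^ i * (x : ℝ) ^ (2 * i) / (2 * i).factorial := by
      intro k
      induction k with
      | zero => simp
      | succ k ih =>
        have h1 : ((((x : ℝ) : ℂ) * Complex.I) ^ (2 * k) / ((2 * k).factorial : ℂ)) =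
            (((-1) ^ k * (x : ℝ) ^ (2 * k) / (2 * k).factorial : ℝ) : ℂ) := by
          rw [mul_pow, pow_mul Complex.I, Complex.I_sq]; push_cast; ring
        have h2 : ((((x : ℝ) : ℂ) * Complex.I) ^ (2 * k + 1) / ((2 * k + 1).factorial : ℂ)) =
            (((-1) ^ k * (x : ℝ) ^ (2 * k + 1) / (2 * k + 1).factorial : ℝ) : ℂ) * Complex.I := by
          rw [mul_pow, pow_succ Complex.I, pow_mul Complex.I, Complex.I_sq]; push_cast; ring
        rw [show 2 * (k + 1) = 2 * k + 1 + 1 by ring, Finset.sum_range_succ,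
          Finset.sum_range_succ, Finset.sum_range_succ, h1, h2, Complex.add_re, Complex.add_re, ih,
          Complex.ofReal_re, Complex.re_ofReal_mul]
        simp
    rw [show 24 = 2 * 12 by norm_num, key 12, cosTaylor]
    push_cast
    rfl
  rw [e] at h2
  refine h2.trans ?_
  calc |(x : ℝ)| ^ 24 / (Nat.factorial 24 : ℝ) * 2
      ≤ (32 / 10) ^ 24 / (Nat.factorial 24 : ℝ) * 2 := by gcongr
    _ ≤ 1 / 10 ^ 11 := by norm_num [Nat.factorial]

theorem abs_cos_sub_cos_le (x y : ℝ) : |Real.cos x - Real.cos y| ≤ |x - y| := by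
  simpa [Real.dist_eq] using Real.lipschitzWith_cos.dist_le_mul x y

/-- A rational approximation of `cos (2πj/n)`, of use for `j ≤ n`. The symmetry `j ↦ n - j` keeps
the argument of the Taylor polynomial in `[0, π]`. -/
def cosApprox (n j : ℕ) : ℚ := cosTaylor (628318530718 / 10 ^ 11 * (min j (n - j) : ℕ) / n)

theorem cos_two_pi_sub {n j : ℕ} (hn : n ≠ 0) (hj : j ≤ n) :
    Real.cos (2 * Real.pi * (n - j : ℕ) / n) = Real.cos (2 * Real.pi * j / n) := by
  have : (n : ℝ) ≠ 0 := by exact_mod_cast hn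
  rw [← Real.cos_two_pi_sub (2 * Real.pi * j / n), Nat.cast_sub hj]
  congr 1
  field_simp

theorem abs_cos_sub_cosApprox_le {n j : ℕ} (hn : n ≠ 0) (hj : j ≤ n) :
    |Real.cos (2 * Real.pi * j / n) - cosApprox n j| ≤ 1 / 10 ^ 10 := by
  have hn' : (0 : ℝ) < n := by exact_mod_cast Nat.pos_of_ne_zero hn
  obtain ⟨i, hi, hi2, hc⟩ : ∃ i : ℕ, i = min j (n - j) ∧ 2 * i ≤ n ∧
      Real.cos (2 * Real.pi * j / n) = Real.cos (2 * Real.pi * i / n) := by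
    rcases le_total j (n - j) with h | h
    · exact ⟨j, by omega, by omega, rfl⟩
    · exact ⟨n - j, by omega, by omega, (cos_two_pi_sub hn hj).symm⟩
  rw [cosApprox, ← hi, hc]
  set y : ℚ := 628318530718 / 10 ^ 11 * i / n with hy
  have hi' : (i : ℝ) / n ≤ 1 / 2 := by
    rw [div_le_div_iff₀ hn' two_pos]
    have : ((2 * i : ℕ) : ℝ) ≤ n := by exact_mod_cast hi2
    push_cast at this; linarith
  have hi0 : 0 ≤ (i : ℝ) / n := by positivity
  have hyr : (y : ℝ) = 628318530718 / 10 ^ 11 * (i / n) := by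
    rw [hy]; push_cast; ring
  have hxr : 2 * Real.pi * i / n = 2 * Real.pi * (i / n) := by ring
  have h1 := abs_cos_sub_cosTaylor_le y (by
    rw [← Rat.cast_le (K := ℝ), Rat.cast_abs, hyr, abs_of_nonneg (by positivity)]
    push_cast; linarith)
  have h2 := abs_cos_sub_cos_le (2 * Real.pi * i / n) y
  have h3 : |2 * Real.pi * i / n - y| ≤ 1 / 10 ^ 12 := by
    rw [hxr, hyr, ← sub_mul, abs_mul, abs_of_nonneg hi0]
    have : |2 * Real.pi - 628318530718 / 10 ^ 11| ≤ 1 / 10 ^ 12 := by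
      have := Real.pi_gt_d20
      have := Real.pi_lt_d20
      rw [abs_le]; constructor <;> linarith
    nlinarith [abs_nonneg (2 * Real.pi - 628318530718 / 10 ^ 11)]
  have h4 := h2.trans h3
  rw [abs_le] at h1 h4 ⊢
  constructor <;> linarith [h1.1, h1.2, h4.1, h4.2]

/-! ### The dual of the knapsack problem -/

/-- The function `θ ↦ -cos θ + cos² θ`: the summand of the stability condition with `k = p`. -/
noncomputable def stabilityCost (θ : ℝ) : ℝ := -Real.cos θ + Real.cos θ ^ 2

/-- The dual function of the fractional knapsack problem on the `n` phases `2πj/n`, with multiplier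
`lam` for the stability condition `k = p`. -/
noncomputable def dualSum (lam : ℝ) (n : ℕ) : ℝ :=
  ∑ j ∈ Finset.range n, max 0 (1 - lam * stabilityCost (2 * Real.pi * j / n))

/-- An upper bound in rational arithmetic of `dualSum lam n`. An error of `10⁻¹⁰` in the cosine `c`
changes `c - c²` by at most `4 / 10¹⁰`. -/
def dualSumApprox (lam : ℚ) (n : ℕ) : ℚ :=
  ∑ j ∈ Finset.range n,
    max 0 (1 + lam * (cosApprox n j - cosApprox n j ^ 2 + 4 / 10 ^ 10))

theorem dualSum_le_dualSumApprox {lam : ℚ} (hl : 0 ≤ lam) {n : ℕ} (hn : n ≠ 0) :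
    dualSum lam n ≤ dualSumApprox lam n := by
  rw [dualSum, dualSumApprox, Rat.cast_sum]
  refine Finset.sum_le_sum fun j hj => ?_
  have h := abs_cos_sub_cosApprox_le hn (Finset.mem_range.1 hj).le
  push_cast
  refine max_le_max le_rfl ?_
  have hl' : (0 : ℝ) ≤ lam := by exact_mod_cast hl
  set c := Real.cos (2 * Real.pi * j / n) with hc
  set m : ℝ := ((cosApprox n j : ℚ) : ℝ)
  have h1 : -1 ≤ c := Real.neg_one_le_cos _
  have h2 : c ≤ 1 := Real.cos_le_one _
  have key : -(-c + c ^ 2) ≤ m - m ^ 2 + 4 / 10 ^ 10 := by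
    rw [abs_le] at h
    nlinarith [h.1, h.2]
  rw [stabilityCost, ← hc]
  nlinarith [mul_le_mul_of_nonneg_left key hl']

/-- Near-optimal multipliers for the phases `2πj/n`, `n ≤ 18`, `n ≠ 4`. The multiplier
`1 / stabilityCost` of the phase at which the budget is exhausted is optimal; when `3`
divides `n`, that phase is `2π/3` and the optimum is `4/3`. -/
def smallMultiplier (n : ℕ) : ℚ :=
  if n = 5 then 7 / 10 else if n = 7 then 36 / 10 else if n = 10 then 247 / 100
  else if n = 13 then 208 / 100 else if n = 16 then 189 / 100 else if n % 3 = 2 then 1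
  else 13 / 10

/-- The case `n = 4` fails, with dual value `3`; no network is stable there. -/
theorem dualSumApprox_smallMultiplier_le :
    ∀ n ∈ Finset.Icc 2 18, n ≠ 4 →
      dualSumApprox (smallMultiplier n) n ≤ 683875 / 10 ^ 6 * n := by
  decide +kernel

/-! ### The value for nineteen phases -/

theorem b19_eq_stabilityCost (l : ℕ) : b19 l = stabilityCost (2 * Real.pi * l / 19) := rfl

/-- A rational approximation of `b19`. -/
def b19Approx (l : ℕ) : ℚ := -cosApprox 19 l + cosApprox 19 l ^ 2

theorem abs_b19_sub_b19Approx_le {l : ℕ} (hl : l ≤ 19) :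
    |b19 l - b19Approx l| ≤ 4 / 10 ^ 10 := by
  have h := abs_cos_sub_cosApprox_le (n := 19) (by norm_num) hl
  rw [b19, b19Approx]
  push_cast at h ⊢
  set c := Real.cos (2 * Real.pi * l / 19) with hc
  set m : ℝ := ((cosApprox 19 l : ℚ) : ℝ)
  have h1 : -1 ≤ c := Real.neg_one_le_cos _
  have h2 : c ≤ 1 := Real.cos_le_one _
  have e : -c + c ^ 2 - (-m + m ^ 2) = (c - m) * (2 * c - 1 - (c - m)) := by ring
  rw [e, abs_mul]
  have h3 : |2 * c - 1 - (c - m)| ≤ 4 := by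
    rw [abs_le] at h ⊢
    constructor <;> linarith [h.1, h.2]
  calc _ ≤ 1 / 10 ^ 10 * (4 : ℝ) := by gcongr
    _ = _ := by norm_num

theorem b19_sub (l : ℕ) (hl : l ≤ 19) : b19 (19 - l) = b19 l := by
  have := cos_two_pi_sub (n := 19) (by norm_num) hl
  push_cast at this
  rw [b19, b19, this]

theorem b19_lt_of_approx {i j : ℕ} (hi : i ≤ 19) (hj : j ≤ 19)
    (h : b19Approx i + 1 / 10 ^ 9 ≤ b19Approx j) : b19 i < b19 j := by
  have h1 := abs_le.1 (abs_b19_sub_b19Approx_le hi)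
  have h2 := abs_le.1 (abs_b19_sub_b19Approx_le hj)
  have h3 : ((b19Approx i + 1 / 10 ^ 9 : ℚ) : ℝ) ≤ (b19Approx j : ℚ) := Rat.cast_le.2 h
  push_cast at h3
  linarith [h1.1, h1.2, h2.1, h2.2]

theorem b19_lt_b19_six {l : ℕ} (hl : l ≤ 5) : b19 l < b19 6 := by
  refine b19_lt_of_approx (by omega) (by norm_num) ?_
  interval_cases l <;> decide +kernel

theorem b19_six_lt {l : ℕ} (hl : 7 ≤ l) (hl' : l ≤ 12) : b19 6 < b19 l := by
  refine b19_lt_of_approx (by norm_num) (by omega) ?_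
  interval_cases l <;> decide +kernel

theorem b19_six_pos : 0 < b19 6 := by
  have h : b19 0 < b19 6 := b19_lt_b19_six (by norm_num)
  simpa [b19] using h

/-- The fraction of the phases `±12π/19` that the optimal solution of the fractional knapsack problem
on the multiples of `2π/19` includes. -/
noncomputable def criticalFraction : ℝ := -(∑ l ∈ Finset.Icc 1 5, b19 l) / b19 6

theorem supMu_eq : supMu = (11 + 2 * criticalFraction) / 19 := by
  rw [supMu, criticalFraction]; ring

theorem criticalFraction_bounds : 0.9968125 ≤ criticalFraction ∧ criticalFraction < 0.996822 := by
  have e : ∑ l ∈ Finset.Icc 1 5, b19 l = b19 1 + b19 2 + b19 3 + b19 4 + b19 5 := by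
    simp [Finset.sum_Icc_succ_top]
  have h := fun l (hl : l ≤ 19) => abs_le.1 (abs_b19_sub_b19Approx_le hl)
  have h1 := h 1 (by norm_num)
  have h2 := h 2 (by norm_num)
  have h3 := h 3 (by norm_num)
  have h4 := h 4 (by norm_num)
  have h5 := h 5 (by norm_num)
  have h6 := h 6 (by norm_num)
  have hp := b19_six_pos
  have l1 : ((9968125 / 10 ^ 7 * b19Approx 6 : ℚ) : ℝ) ≤ (-(b19Approx 1 + b19Approx 2 + b19Approx 3 +
      b19Approx 4 + b19Approx 5) - 1 / 10 ^ 8 : ℚ) :=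
    Rat.cast_le.2 (by decide +kernel)
  have l2 : ((-(b19Approx 1 + b19Approx 2 + b19Approx 3 +
      b19Approx 4 + b19Approx 5) + 1 / 10 ^ 8 : ℚ) : ℝ) ≤ (996822 / 10 ^ 6 * b19Approx 6 : ℚ) :=
    Rat.cast_le.2 (by decide +kernel)
  push_cast at l1 l2
  rw [criticalFraction, e, le_div_iff₀ hp, div_lt_iff₀ hp]
  constructor <;> linarith [h1.1, h1.2, h2.1, h2.2, h3.1, h3.2, h4.1, h4.2, h5.1, h5.2, h6.1, h6.2]

theorem supMu_bounds : 0.683875 ≤ supMu ∧ supMu < 0.683876 := by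
  have h := criticalFraction_bounds
  rw [supMu_eq]
  constructor <;> linarith [h.1, h.2]

/-- For `n = 19` the multiplier that makes the phases `±12π/19` critical attains the closed form. -/
theorem dualSum_nineteen : dualSum (1 / b19 6) 19 = 19 * supMu := by
  have hp := b19_six_pos
  have hlow : ∀ l, l ≤ 5 → max 0 (1 - 1 / b19 6 * b19 l) = 1 - 1 / b19 6 * b19 l := by
    intro l hl
    refine max_eq_right ?_
    rw [one_div_mul_eq_div, sub_nonneg, div_le_one hp]
    exact (b19_lt_b19_six hl).le
  have hhigh : ∀ l, b19 6 ≤ b19 l → max 0 (1 - 1 / b19 6 * b19 l) = 0 := by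
    intro l hl
    refine max_eq_left ?_
    rw [one_div_mul_eq_div, sub_nonpos, one_le_div hp]
    exact hl
  have hs : ∀ l ≤ 19, b19 (19 - l) = b19 l := b19_sub
  have h0 : b19 0 = 0 := by simp [b19]
  have e : dualSum (1 / b19 6) 19 =
      ∑ j ∈ Finset.range 19, max 0 (1 - 1 / b19 6 * b19 j) := by
    simp only [dualSum, b19_eq_stabilityCost]; norm_num
  rw [e]
  simp only [Finset.sum_range_succ, Finset.sum_range_zero]
  rw [← hs 18 (by norm_num), ← hs 17 (by norm_num), ← hs 16 (by norm_num), ← hs 15 (by norm_num),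
    ← hs 14 (by norm_num), ← hs 13 (by norm_num)]
  norm_num only
  rw [hlow 0 (by norm_num), hlow 1 (by norm_num), hlow 2 (by norm_num), hlow 3 (by norm_num),
    hlow 4 (by norm_num), hlow 5 (by norm_num), hhigh 6 le_rfl,
    hhigh 7 (b19_six_lt (by norm_num) (by norm_num)).le,
    hhigh 8 (b19_six_lt (by norm_num) (by norm_num)).le,
    hhigh 9 (b19_six_lt (by norm_num) (by norm_num)).le,
    hhigh 10 (b19_six_lt (by norm_num) (by norm_num)).le,
    hhigh 11 (b19_six_lt (by norm_num) (by norm_num)).le,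
    hhigh 12 (b19_six_lt (by norm_num) (by norm_num)).le, h0]
  rw [supMu]
  simp only [Finset.sum_Icc_succ_top, Nat.one_le_ofNat, Finset.Icc_self, Finset.sum_singleton,
    Nat.reduceAdd]
  field_simp
  ring

/-! ### Reduction of the integer program to the dual function -/

theorem sum_range_eq_add_sum_Icc {N : ℕ} (hN : 1 ≤ N) (f : ℕ → ℝ) :
    ∑ l ∈ Finset.range N, f l = f 0 + ∑ l ∈ Finset.Icc 1 (N - 1), f l := by
  rw [Finset.range_eq_Ico, Finset.sum_eq_sum_Ico_succ_bot (by omega)]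
  congr 2

theorem twistedL_self (N p l : ℕ) :
    twistedL N p p l = stabilityCost (2 * Real.pi * p * l / N) := by
  rw [twistedL, stabilityCost]; ring

/-- Weak duality for the constraint `k = p`. The summand `1` on the left is the term `l = 0`. -/
theorem sum_add_one_le_of_isFeasible {N p : ℕ} (hp : 1 ≤ p) (hpN : p ≤ N / 2)
    {x : ℕ → ℝ} (hx : IsFeasible N p x) {lam : ℝ} (hl : 0 ≤ lam) :
    ∑ l ∈ Finset.Icc 1 (N - 1), x l + 1 ≤
      ∑ l ∈ Finset.range N, max 0 (1 - lam * stabilityCost (2 * Real.pi * p * l / N)) := by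
  rw [sum_range_eq_add_sum_Icc (by omega)]
  have h0 : (1 : ℝ) ≤ max 0 (1 - lam * stabilityCost (2 * Real.pi * p * (0 : ℕ) / N)) := by
    simp [stabilityCost]
  have hs := hx.stable p (Finset.mem_Icc.2 ⟨hp, by omega⟩)
  simp only [twistedL_self] at hs
  have h1 : ∑ l ∈ Finset.Icc 1 (N - 1), x l ≤
      ∑ l ∈ Finset.Icc 1 (N - 1), (x l - lam * (stabilityCost (2 * Real.pi * p * l / N) * x l)) := by
    rw [Finset.sum_sub_distrib, ← Finset.mul_sum]
    nlinarith
  have h2 : ∑ l ∈ Finset.Icc 1 (N - 1),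
        (x l - lam * (stabilityCost (2 * Real.pi * p * l / N) * x l)) ≤
      ∑ l ∈ Finset.Icc 1 (N - 1), max 0 (1 - lam * stabilityCost (2 * Real.pi * p * l / N)) := by
    refine Finset.sum_le_sum fun l hl => ?_
    rcases hx.binary l hl with h | h
    · rw [h]; simp
    · rw [h, mul_one]; exact le_max_right _ _
  linarith

theorem sum_range_mul_of_periodic (g n : ℕ) (f : ℕ → ℝ) (hf : ∀ j, f (j + n) = f j) :
    ∑ l ∈ Finset.range (g * n), f l = g * ∑ j ∈ Finset.range n, f j := by
  induction g with
  | zero => simp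
  | succ g ih =>
    have hper : ∀ (a j : ℕ), f (a * n + j) = f j := by
      intro a j
      induction a with
      | zero => simp
      | succ a iha => rw [show (a + 1) * n + j = a * n + j + n by ring, hf, iha]
    rw [Nat.add_mul, one_mul, Finset.sum_range_add, ih]
    simp only [hper]
    push_cast; ring

theorem sum_range_mul_left_of_coprime {n q : ℕ} (hn : 0 < n) (hq : Nat.Coprime q n) (f : ℕ → ℝ)
    (hf : ∀ j, f (j % n) = f j) :
    ∑ j ∈ Finset.range n, f (q * j) = ∑ j ∈ Finset.range n, f j := by
  have himg : (Finset.range n).image (fun j => q * j % n) = Finset.range n := by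
    refine Finset.eq_of_subset_of_card_le ?_ ?_
    · intro i hi
      obtain ⟨j, -, rfl⟩ := Finset.mem_image.1 hi
      exact Finset.mem_range.2 (Nat.mod_lt _ hn)
    · rw [Finset.card_image_of_injOn]
      intro i hi j hj hij
      have : i ≡ j [MOD n] := Nat.ModEq.cancel_left_of_coprime (by rwa [Nat.gcd_comm]) hij
      exact Nat.ModEq.eq_of_lt_of_lt this (Finset.mem_range.1 hi) (Finset.mem_range.1 hj)
  have hinj : Set.InjOn (fun j => q * j % n) (Finset.range n : Finset ℕ) := by
    rw [← Finset.card_image_iff, himg]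
  calc _ = ∑ j ∈ Finset.range n, f (q * j % n) := by simp only [hf]
    _ = ∑ j ∈ (Finset.range n).image (fun j => q * j % n), f j := by
        rw [Finset.sum_image hinj]
    _ = _ := by rw [himg]

/-- With `g = gcd(N, p)`, the phases `2πpl/N` run `g` times through the phases `2πj/(N/g)`. -/
theorem sum_range_phase_eq {N p : ℕ} (hN : 0 < N) (F : ℝ → ℝ)
    (hF : Function.Periodic F (2 * Real.pi)) :
    ∑ l ∈ Finset.range N, F (2 * Real.pi * p * l / N) =
      (N.gcd p : ℝ) * ∑ j ∈ Finset.range (N / N.gcd p),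
        F (2 * Real.pi * j / (N / N.gcd p : ℕ)) := by
  obtain ⟨g, hg⟩ : ∃ g, g = N.gcd p := ⟨_, rfl⟩
  have hgpos : 0 < g := hg ▸ Nat.gcd_pos_of_pos_left _ hN
  obtain ⟨n, hn⟩ : g ∣ N := hg ▸ Nat.gcd_dvd_left _ _
  obtain ⟨q, hq⟩ : g ∣ p := hg ▸ Nat.gcd_dvd_right _ _
  have hnpos : 0 < n := Nat.pos_of_ne_zero (by rintro rfl; omega)
  have hcop : Nat.Coprime q n := by
    rw [hn, hq, Nat.gcd_mul_left] at hg
    exact (Nat.gcd_comm _ _).trans (Nat.eq_of_mul_eq_mul_left hgpos (by rw [← hg, mul_one]))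
  rw [← hg, hn, Nat.mul_div_cancel_left _ hgpos, hq]
  have hg0 : (g : ℝ) ≠ 0 := by exact_mod_cast hgpos.ne'
  have hn0 : (n : ℝ) ≠ 0 := by exact_mod_cast hnpos.ne'
  have hmod : ∀ j : ℕ, F (2 * Real.pi * (j % n : ℕ) / n) = F (2 * Real.pi * j / n) := by
    intro j
    have := (hF.nat_mul (j / n)) (2 * Real.pi * (j % n : ℕ) / n)
    rw [← this]
    congr 1
    have h : (j : ℝ) = (j % n : ℕ) + n * (j / n : ℕ) := by
      exact_mod_cast (Nat.mod_add_div j n).symm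
    rw [h]; field_simp
  calc _ = ∑ l ∈ Finset.range (g * n), F (2 * Real.pi * (q * l : ℕ) / n) := by
        refine Finset.sum_congr rfl fun l _ => ?_
        congr 1; push_cast; field_simp
    _ = g * ∑ j ∈ Finset.range n, F (2 * Real.pi * (q * j : ℕ) / n) := by
        refine sum_range_mul_of_periodic g n _ fun j => ?_
        rw [← hmod, ← hmod (q * j)]
        congr 4
        rw [mul_add, Nat.add_mul_mod_self_right]
    _ = _ := by
        rw [sum_range_mul_left_of_coprime hnpos hcop (fun j => F (2 * Real.pi * j / n)) hmod]

theorem stabilityCost_periodic : Function.Periodic stabilityCost (2 * Real.pi) := by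
  intro x; simp [stabilityCost]

theorem sum_add_one_le_gcd_mul_dualSum {N p : ℕ} (hp : 1 ≤ p) (hpN : p ≤ N / 2)
    {x : ℕ → ℝ} (hx : IsFeasible N p x) {lam : ℝ} (hl : 0 ≤ lam) :
    ∑ l ∈ Finset.Icc 1 (N - 1), x l + 1 ≤ N.gcd p * dualSum lam (N / N.gcd p) := by
  refine (sum_add_one_le_of_isFeasible hp hpN hx hl).trans_eq ?_
  exact sum_range_phase_eq (by omega) (fun θ => max 0 (1 - lam * stabilityCost θ)) fun θ => by
    simp only [stabilityCost_periodic θ]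

theorem stabilityCost_nonneg_of_four (j : ℕ) : 0 ≤ stabilityCost (2 * Real.pi * j / 4) := by
  have h : ∀ c : ℝ, c = 0 ∨ c = 1 ∨ c = -1 → 0 ≤ -c + c ^ 2 := by
    rintro c (rfl | rfl | rfl) <;> norm_num
  refine h _ ?_
  have e : 2 * Real.pi * j / 4 = j * (Real.pi / 2) := by ring
  rw [e]
  rcases Nat.even_or_odd' j with ⟨i, rfl | rfl⟩
  · have : ((2 * i : ℕ) : ℝ) * (Real.pi / 2) = i * Real.pi := by push_cast; ring
    rw [this, Real.cos_nat_mul_pi]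
    rcases neg_one_pow_eq_or ℝ i with h | h <;> simp [h]
  · left
    have : ((2 * i + 1 : ℕ) : ℝ) * (Real.pi / 2) = i * Real.pi + Real.pi / 2 := by push_cast; ring
    rw [this, Real.cos_add_pi_div_two, Real.sin_nat_mul_pi, neg_zero]

/-- If the phases `2πpl/N` are multiples of `π/2`, no network is stable. -/
theorem not_isFeasible_of_div_gcd_eq_four {N p : ℕ} (hp : 1 ≤ p) (hpN : p ≤ N / 2)
    (h4 : N / N.gcd p = 4) (x : ℕ → ℝ) : ¬ IsFeasible N p x := by
  intro hx
  have hs := hx.stable p (Finset.mem_Icc.2 ⟨hp, by omega⟩)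
  refine absurd hs (not_lt.2 (Finset.sum_nonneg fun l hl => ?_))
  refine mul_nonneg ?_ ?_
  · rw [twistedL_self]
    obtain ⟨q, hq⟩ := Nat.gcd_dvd_right N p
    have hgpos : 0 < N.gcd p := Nat.gcd_pos_of_pos_right _ hp
    have hN : N = N.gcd p * 4 := by
      rw [← h4, Nat.mul_div_cancel' (Nat.gcd_dvd_left _ _)]
    have hg0 : (N.gcd p : ℝ) ≠ 0 := by exact_mod_cast hgpos.ne'
    have hN' : (N : ℝ) = N.gcd p * 4 := by exact_mod_cast hN
    have hp' : (p : ℝ) = N.gcd p * q := by exact_mod_cast hq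
    have e : 2 * Real.pi * p * l / N = 2 * Real.pi * (q * l : ℕ) / 4 := by
      rw [div_eq_div_iff (by rw [hN']; positivity) (by norm_num)]
      push_cast
      linear_combination (8 * Real.pi * l) * hp' - 2 * Real.pi * q * l * hN'
    rw [e]
    exact stabilityCost_nonneg_of_four _
  · rcases hx.binary l hl with h | h <;> simp [h]

/-! ### Dirichlet sums and the dual function for many phases -/

theorem two_mul_sin_mul_sum_cos (α d : ℝ) (n : ℕ) :
    2 * Real.sin (d / 2) * ∑ i ∈ Finset.range n, Real.cos (α + i * d) =
      Real.sin (α + n * d - d / 2) - Real.sin (α - d / 2) := by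
  induction n with
  | zero => simp
  | succ n ih =>
    rw [Finset.sum_range_succ, mul_add, ih]
    have e1 : α + (n + 1 : ℕ) * d - d / 2 = (α + n * d) + d / 2 := by push_cast; ring
    rw [e1, Real.sin_add (α + n * d), Real.sin_sub (α + n * d)]
    ring

theorem sin_mul_dirichlet_sum (h : ℝ) (J : ℕ) :
    Real.sin (h / 2) * (1 + 2 * ∑ i ∈ Finset.range J, Real.cos ((i + 1 : ℕ) * h)) =
      Real.sin ((J + 1 / 2) * h) := by
  have e := two_mul_sin_mul_sum_cos h h J
  have e2 : ∀ i : ℕ, Real.cos ((i + 1 : ℕ) * h) = Real.cos (h + i * h) := fun i => by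
    congr 1; push_cast; ring
  simp only [e2]
  have e3 : h + J * h - h / 2 = (J + 1 / 2) * h := by ring
  have e4 : h - h / 2 = h / 2 := by ring
  rw [e3, e4] at e
  linarith

/-- The middle term, present for even `n`, is assumed to vanish. -/
theorem sum_range_eq_of_symm {n : ℕ} (g : ℕ → ℝ) (hg : ∀ j ≤ n, g (n - j) = g j)
    (hmid : ∀ j, 2 * j = n → g j = 0) (hn : 1 ≤ n) :
    ∑ j ∈ Finset.range n, g j = g 0 + 2 * ∑ i ∈ Finset.range ((n - 1) / 2), g (i + 1) := by
  obtain ⟨M, hM | hM⟩ : ∃ M, n = 2 * M + 1 ∨ n = 2 * M + 2 := ⟨(n - 1) / 2, by omega⟩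
  · have h1 : (n - 1) / 2 = M := by omega
    have h2 : ∑ i ∈ Finset.range M, g (M + 1 + i) = ∑ i ∈ Finset.range M, g (i + 1) := by
      rw [← Finset.sum_range_reflect]
      refine Finset.sum_congr rfl fun i hi => ?_
      have := Finset.mem_range.1 hi
      rw [← hg (i + 1) (by omega)]; congr 1; omega
    rw [h1, hM, show 2 * M + 1 = M + 1 + M by ring, Finset.sum_range_add, h2,
      Finset.sum_range_succ']
    ring
  · have h1 : (n - 1) / 2 = M := by omega
    have h2 : ∑ i ∈ Finset.range M, g (M + 2 + i) = ∑ i ∈ Finset.range M, g (i + 1) := by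
      rw [← Finset.sum_range_reflect]
      refine Finset.sum_congr rfl fun i hi => ?_
      have := Finset.mem_range.1 hi
      rw [← hg (i + 1) (by omega)]; congr 1; omega
    rw [h1, hM, show 2 * M + 2 = M + 2 + M by ring, Finset.sum_range_add, h2,
      Finset.sum_range_succ, hmid (M + 1) (by omega), Finset.sum_range_succ']
    ring

/-- If the positive terms of a sequence come before all others, the sum of the positive parts is a
partial sum. -/
theorem exists_sum_max_zero_eq (g : ℕ → ℝ) (M : ℕ)
    (hg : ∀ i j, i ≤ j → j < M → 0 ≤ g j → 0 ≤ g i) :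
    ∃ J ≤ M, ∑ i ∈ Finset.range M, max 0 (g i) = ∑ i ∈ Finset.range J, g i := by
  induction M with
  | zero => exact ⟨0, le_rfl, by simp⟩
  | succ M ih =>
    by_cases h : 0 ≤ g M
    · refine ⟨M + 1, le_rfl, Finset.sum_congr rfl fun i hi => max_eq_right ?_⟩
      exact hg i M (Nat.lt_succ_iff.1 (Finset.mem_range.1 hi)) (Nat.lt_succ_self _) h
    · obtain ⟨J, hJ, e⟩ := ih fun i j hij hj => hg i j hij (hj.trans (Nat.lt_succ_self _))
      exact ⟨J, hJ.trans (Nat.le_succ _), by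
        rw [Finset.sum_range_succ, e, max_eq_left (not_le.1 h).le, add_zero]⟩

/-- The positive terms of the dual function are those with `|j| ≤ J`. The condition on
`lam` makes the term of the phase `π` nonpositive. -/
theorem exists_dualSum_eq {lam : ℝ} (hl : 1 / 2 ≤ lam) {n : ℕ} (hn : 1 ≤ n) :
    ∃ J : ℕ, 2 * J + 1 ≤ n ∧ dualSum lam n =
      1 + 2 * ∑ i ∈ Finset.range J, (1 - lam * stabilityCost ((i + 1 : ℕ) * (2 * Real.pi / n))) := by
  have hn0 : (0 : ℝ) < n := by exact_mod_cast hn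
  have e1 : ∀ j : ℕ, 2 * Real.pi * j / n = j * (2 * Real.pi / n) := fun j => by ring
  have hsum := sum_range_eq_of_symm (n := n)
    (fun j => max 0 (1 - lam * stabilityCost (2 * Real.pi * j / n)))
    (fun j hj => by simp only [stabilityCost, cos_two_pi_sub (n := n) (by omega) hj])
    (fun j hj => by
      have : 2 * Real.pi * j / n = Real.pi := by
        rw [← hj]; push_cast
        have : (j : ℝ) ≠ 0 := by
          have : j ≠ 0 := by omega
          exact_mod_cast this
        field_simp
      simp only [this, stabilityCost, Real.cos_pi]
      exact max_eq_left (by linarith)) hn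
  obtain ⟨J, hJ, e⟩ := exists_sum_max_zero_eq
    (fun i => 1 - lam * stabilityCost ((i + 1 : ℕ) * (2 * Real.pi / n))) ((n - 1) / 2) (by
      intro i j hij hj h0
      have hc : Real.cos ((j + 1 : ℕ) * (2 * Real.pi / n)) ≤
          Real.cos ((i + 1 : ℕ) * (2 * Real.pi / n)) := by
        refine Real.cos_le_cos_of_nonneg_of_le_pi (by positivity) ?_ (by gcongr)
        rw [mul_div_assoc', div_le_iff₀ hn0]
        have : ((2 * (j + 1) : ℕ) : ℝ) ≤ n := by exact_mod_cast (by omega : 2 * (j + 1) ≤ n)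
        push_cast at this ⊢
        nlinarith [Real.pi_pos]
      have hc1 := Real.cos_le_one ((i + 1 : ℕ) * (2 * Real.pi / n))
      simp only [stabilityCost] at h0 ⊢
      set a := Real.cos ((j + 1 : ℕ) * (2 * Real.pi / n))
      set c := Real.cos ((i + 1 : ℕ) * (2 * Real.pi / n))
      -- `t ↦ t - t²` is nonnegative on `[0, 1]` and increasing on the negative numbers.
      rcases le_or_gt 0 c with h | h
      · nlinarith [mul_nonneg h (sub_nonneg.2 hc1)]
      · nlinarith [mul_nonneg (sub_nonneg.2 hc) (by linarith : 0 ≤ 1 - a - c)])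
  refine ⟨J, by omega, ?_⟩
  rw [dualSum, hsum, ← e]
  simp only [e1]
  simp [stabilityCost]

/-- The graph of the sine lies below its tangents on `[0, π]`. -/
theorem sin_le_tangent {x y : ℝ} (hx : x ∈ Set.Icc 0 Real.pi) (hy : y ∈ Set.Icc 0 Real.pi) :
    Real.sin y ≤ Real.sin x + Real.cos x * (y - x) := by
  have hc := strictConcaveOn_sin_Icc.concaveOn
  rcases lt_trichotomy x y with h | h | h
  · have := hc.slope_le_of_hasDerivAt hx hy h (Real.hasDerivAt_sin x)
    rw [slope_def_field, div_le_iff₀ (by linarith)] at this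
    linarith
  · simp [h]
  · have := hc.le_slope_of_hasDerivAt hy hx h (Real.hasDerivAt_sin x)
    rw [slope_def_field, le_div_iff₀ (by linarith)] at this
    linarith

/-- The maximum of the left-hand side is attained near `φ = 2.1429`. The coefficients are upper bounds
of `1.2 h / sin (h/2)` and `0.6 h / sin h` at `h = π/10`; the right-hand side is just below
`2π * 0.683875`. -/
theorem profile_le {φ : ℝ} (h1 : Real.pi / 2 ≤ φ) (h2 : φ ≤ Real.pi) :
    0.8 * φ + 2.409912 * Real.sin φ - 0.610036 * Real.sin (2 * φ) ≤ 4.2968 := by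
  have hpi1 := Real.pi_gt_d4
  have hpi2 := Real.pi_lt_d4
  have t1 := sin_le_tangent (x := 2.1429) (y := φ) ⟨by norm_num, by linarith⟩ ⟨by linarith, h2⟩
  have t2 := sin_le_tangent (x := 2 * 2.1429 - Real.pi) (y := 2 * φ - Real.pi)
    ⟨by linarith, by linarith⟩ ⟨by linarith, by linarith⟩
  rw [Real.sin_sub_pi, Real.sin_sub_pi, Real.cos_sub_pi, Real.sin_two_mul 2.1429,
    Real.cos_two_mul 2.1429] at t2
  have ht := abs_le.1 (abs_cos_sub_cosTaylor_le (21429 / 10000) (by norm_num [abs_le]))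
  have b1 : ((-541403 / 10 ^ 6 : ℚ) : ℝ) ≤ (cosTaylor (21429 / 10000) - 1 / 10 ^ 11 : ℚ) :=
    Rat.cast_le.2 (by decide +kernel)
  have b2 : ((cosTaylor (21429 / 10000) + 1 / 10 ^ 11 : ℚ) : ℝ) ≤ (-541401 / 10 ^ 6 : ℚ) :=
    Rat.cast_le.2 (by decide +kernel)
  push_cast at ht b1 b2
  have e : (21429 / 10000 : ℝ) = 2.1429 := by norm_num
  rw [e] at ht
  have hc1 : -0.541403 ≤ Real.cos 2.1429 := by linarith [ht.1]
  have hc2 : Real.cos 2.1429 ≤ -0.541401 := by linarith [ht.2]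
  have hsc := Real.sin_sq_add_cos_sq 2.1429
  have hs0 : 0 ≤ Real.sin 2.1429 := Real.sin_nonneg_of_nonneg_of_le_pi (by norm_num) (by linarith)
  set c := Real.cos 2.1429
  set s := Real.sin 2.1429
  have hs1 : s ≤ 0.840767 := by nlinarith
  have hcc : c ^ 2 ≤ 0.29312 := by nlinarith
  have hcc' : 0.293115 ≤ c ^ 2 := by nlinarith
  have hd : |φ - 2.1429| ≤ 1 := by rw [abs_le]; constructor <;> linarith
  -- the slope at `2.1429` of the left-hand side is small
  have hE : |0.8 + 2.409912 * c - 2 * 0.610036 * (2 * c ^ 2 - 1)| ≤ 1 / 2000 := by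
    rw [abs_le]; constructor <;> linarith
  have hprod := (abs_mul (0.8 + 2.409912 * c - 2 * 0.610036 * (2 * c ^ 2 - 1)) (φ - 2.1429)).le.trans
    (mul_le_mul hE hd (abs_nonneg _) (by norm_num))
  have hprod' := (le_abs_self _).trans hprod
  have hsc2 : -(s * c) ≤ 0.840767 * 0.541403 := by nlinarith
  linarith

/-- With `h = 2π/n` and `φ = (J + 1/2) h`, the left-hand side is `h` times the sum over `|j| ≤ J` of
`1 - 1.2 * stabilityCost (j h)`, where `D1` and `D2` are the Dirichlet kernels at `h` and `2h`. -/
theorem scaled_dirichlet_le {h φ D1 D2 : ℝ} (hpos : 0 < h) (hle : h ≤ 0.31416) (hφ0 : 0 ≤ φ)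
    (hφpi : φ ≤ Real.pi) (hD1 : Real.sin (h / 2) * D1 = Real.sin φ)
    (hD2 : Real.sin h * D2 = Real.sin (2 * φ)) :
    0.8 * φ + 1.2 * (h * D1) - 0.6 * (h * D2) ≤ 4.2968 := by
  have hpi2 := Real.pi_lt_d4
  have hsφ : 0 ≤ Real.sin φ := Real.sin_nonneg_of_nonneg_of_le_pi hφ0 hφpi
  have hs1 := Real.sin_ge_sub_cube (x := h / 2) (by linarith)
  have hs2 := Real.sin_ge_sub_cube (x := h) hpos.le
  have hsq : h ^ 2 ≤ 0.0986966 := by nlinarith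
  have hcube : h ^ 3 ≤ 0.0986966 * h := by
    calc h ^ 3 = h ^ 2 * h := by ring
      _ ≤ _ := by gcongr
  have hs1' : h ≤ 2.00826 * Real.sin (h / 2) := by
    rw [div_pow] at hs1; linarith
  have hs2' : h ≤ 1.016726 * Real.sin h := by linarith
  have hp1 : 0 < Real.sin (h / 2) := by linarith
  have hp2 : 0 < Real.sin h := by linarith
  have hD1nn : 0 ≤ D1 := (mul_nonneg_iff_of_pos_left hp1).1 (by rwa [hD1])
  have hB1 : h * D1 ≤ 2.00826 * Real.sin φ := by
    rw [← hD1, ← mul_assoc]; exact mul_le_mul_of_nonneg_right hs1' hD1nn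
  rcases le_total φ (Real.pi / 2) with hc | hc
  · have hs2φ : 0 ≤ Real.sin (2 * φ) :=
      Real.sin_nonneg_of_nonneg_of_le_pi (by linarith) (by linarith)
    have hD2nn : 0 ≤ D2 := (mul_nonneg_iff_of_pos_left hp2).1 (by rwa [hD2])
    have := Real.sin_le_one φ
    have := mul_nonneg hpos.le hD2nn
    linarith
  · have hs2φ : Real.sin (2 * φ) ≤ 0 := by
      rw [Real.sin_two_mul]
      have := Real.cos_nonpos_of_pi_div_two_le_of_le hc (by linarith)
      exact mul_nonpos_of_nonneg_of_nonpos (by positivity) this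
    have hD2np : 0 ≤ -D2 := (mul_nonneg_iff_of_pos_left hp2).1 (by rw [mul_neg, hD2]; linarith)
    have hB2 : h * -D2 ≤ 1.016726 * -Real.sin (2 * φ) := by
      rw [← hD2, ← mul_neg, ← mul_assoc]; exact mul_le_mul_of_nonneg_right hs2' hD2np
    have := profile_le hc hφpi
    linarith

theorem dualSum_le_of_twenty_le {n : ℕ} (hn : 20 ≤ n) : dualSum 1.2 n ≤ 0.683875 * n := by
  obtain ⟨J, hJ, e⟩ := exists_dualSum_eq (lam := 1.2) (by norm_num) (n := n) (by omega)
  have hn0 : (20 : ℝ) ≤ n := by exact_mod_cast hn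
  obtain ⟨h, hh⟩ : ∃ h, h = 2 * Real.pi / n := ⟨_, rfl⟩
  rw [← hh] at e
  have hpi2 := Real.pi_lt_d4
  have hpos : 0 < h := by rw [hh]; positivity
  have hle : h ≤ 0.31416 := by
    rw [hh, div_le_iff₀ (by linarith)]; linarith
  have hnh : n * h = 2 * Real.pi := by rw [hh]; field_simp
  have hD1 := sin_mul_dirichlet_sum h J
  have hD2 := sin_mul_dirichlet_sum (2 * h) J
  rw [show (2 * h) / 2 = h by ring,
    show (J + 1 / 2 : ℝ) * (2 * h) = 2 * ((J + 1 / 2) * h) by ring] at hD2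
  have hSD : dualSum 1.2 n = 0.4 * (2 * J + 1) +
      1.2 * (1 + 2 * ∑ i ∈ Finset.range J, Real.cos ((i + 1 : ℕ) * h)) -
      0.6 * (1 + 2 * ∑ i ∈ Finset.range J, Real.cos ((i + 1 : ℕ) * (2 * h))) := by
    have : ∀ i : ℕ, 1 - 1.2 * stabilityCost ((i + 1 : ℕ) * h) = 0.4 +
        1.2 * Real.cos ((i + 1 : ℕ) * h) - 0.6 * Real.cos ((i + 1 : ℕ) * (2 * h)) := by
      intro i
      rw [show ((i + 1 : ℕ) : ℝ) * (2 * h) = 2 * ((i + 1 : ℕ) * h) by ring, Real.cos_two_mul,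
        stabilityCost]
      ring
    simp only [e, this, Finset.sum_add_distrib, Finset.sum_sub_distrib, ← Finset.mul_sum,
      Finset.sum_const, Finset.card_range, nsmul_eq_mul]
    ring
  have hφpi : (J + 1 / 2) * h ≤ Real.pi := by
    have : ((2 * J + 1 : ℕ) : ℝ) ≤ n := by exact_mod_cast hJ
    push_cast at this
    calc (J + 1 / 2) * h ≤ (n / 2) * h := by gcongr; linarith
      _ = Real.pi := by linarith
  have hS := scaled_dirichlet_le hpos hle (by positivity) hφpi hD1 hD2
  have hhS : h * dualSum 1.2 n ≤ 4.2968 := by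
    refine le_of_eq_of_le ?_ hS
    rw [hSD]; ring
  have : dualSum 1.2 n * (2 * Real.pi) ≤ 0.683875 * n * (2 * Real.pi) := by
    calc dualSum 1.2 n * (2 * Real.pi) = n * (h * dualSum 1.2 n) := by rw [← hnh]; ring
      _ ≤ n * 4.2968 := by gcongr
      _ ≤ n * (0.683875 * (2 * Real.pi)) := by
        gcongr; linarith [Real.pi_gt_d6]
      _ = _ := by ring
  exact le_of_mul_le_mul_right this (by positivity)

theorem exists_dualSum_le {n : ℕ} (hn : 2 ≤ n) (h4 : n ≠ 4) :
    ∃ lam : ℝ, 0 ≤ lam ∧ dualSum lam n ≤ n * supMu := by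
  have hn0 : (0 : ℝ) ≤ n := Nat.cast_nonneg n
  have hmu := supMu_bounds.1
  rcases lt_trichotomy n 19 with h | h | h
  · refine ⟨smallMultiplier n, ?_, ?_⟩
    · have : 0 ≤ smallMultiplier n := by
        unfold smallMultiplier; split_ifs <;> norm_num
      exact_mod_cast this
    have hpos : 0 ≤ smallMultiplier n := by
      unfold smallMultiplier; split_ifs <;> norm_num
    have h1 := dualSum_le_dualSumApprox hpos (n := n) (by omega)
    have h2 : ((dualSumApprox (smallMultiplier n) n : ℚ) : ℝ) ≤ (683875 / 10 ^ 6 * n : ℚ) :=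
      Rat.cast_le.2
        (dualSumApprox_smallMultiplier_le n (Finset.mem_Icc.2 ⟨hn, by omega⟩) h4)
    push_cast at h2
    nlinarith
  · subst h
    exact ⟨1 / b19 6, (one_div_pos.2 b19_six_pos).le, dualSum_nineteen.le.trans (by norm_num)⟩
  · refine ⟨1.2, by norm_num, (dualSum_le_of_twenty_le h).trans ?_⟩
    nlinarith

/-- The upper bound for all `(N, p)`. The objective has the denominator `N - 1`, but passing from
`S / (N - 1)` to `(S + 1) / N` only increases it, as `S ≤ N - 1`. -/
theorem circulantConnectivity_le_supMu {N p : ℕ} (hp : 1 ≤ p) (hpN : p ≤ N / 2) {x : ℕ → ℝ}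
    (hx : IsFeasible N p x) : circulantConnectivity N x ≤ supMu := by
  have hN2 : 2 ≤ N := by omega
  obtain ⟨n, hn⟩ : ∃ n, n = N / N.gcd p := ⟨_, rfl⟩
  have hgpos : 0 < N.gcd p := Nat.gcd_pos_of_pos_right _ hp
  have hgn : N.gcd p * n = N := by rw [hn, Nat.mul_div_cancel' (Nat.gcd_dvd_left _ _)]
  have hgp : N.gcd p ≤ p := Nat.le_of_dvd hp (Nat.gcd_dvd_right _ _)
  have hn2 : 2 ≤ n := by
    by_contra hlt
    have : N.gcd p * n ≤ p * 1 := Nat.mul_le_mul hgp (by omega)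
    omega
  obtain ⟨lam, hl, hle⟩ := exists_dualSum_le hn2 (fun h =>
    not_isFeasible_of_div_gcd_eq_four hp hpN (hn.symm.trans h) x hx)
  have h1 := sum_add_one_le_gcd_mul_dualSum hp hpN hx hl
  rw [← hn] at h1
  have h2 : ∑ l ∈ Finset.Icc 1 (N - 1), x l + 1 ≤ N * supMu := by
    refine h1.trans ((mul_le_mul_of_nonneg_left hle (Nat.cast_nonneg _)).trans_eq ?_)
    rw [← mul_assoc]; congr 1; exact_mod_cast hgn
  have hN1 : (2 : ℝ) ≤ N := by exact_mod_cast hN2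
  rw [circulantConnectivity, div_le_iff₀ (by linarith)]
  linarith [supMu_bounds.2]

/-! ### Near-optimal networks for `N = 19m` and `p = m` -/

/-- The configuration of the `(19m, m)` program that contains all `l ≡ 0, ±1, …, ±5` modulo `19`,
and `a` of the `m` indices in each of the classes `±6`. The elements of the class `-6` are the last
ones, so that the configuration is symmetric. -/
noncomputable def nearOptimal (m a l : ℕ) : ℝ :=
  if l % 19 = 6 then (if l / 19 < a then 1 else 0)
  else if l % 19 = 13 then (if m - a ≤ l / 19 then 1 else 0)
  else if 7 ≤ l % 19 ∧ l % 19 ≤ 12 then 0 else 1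

theorem nearOptimal_eq_zero_or_one (m a l : ℕ) : nearOptimal m a l = 0 ∨ nearOptimal m a l = 1 := by
  unfold nearOptimal; split_ifs <;> simp

theorem nearOptimal_symm {m a : ℕ} (ha : a ≤ m) {l : ℕ} (hlm : l < 19 * m) :
    nearOptimal m a l = nearOptimal m a (19 * m - l) := by
  unfold nearOptimal
  by_cases h0 : l % 19 = 0
  · have h1 : (19 * m - l) % 19 = 0 := by omega
    simp [h0, h1]
  · have h1 : (19 * m - l) % 19 = 19 - l % 19 := by omega
    have h2 : (19 * m - l) / 19 = m - 1 - l / 19 := by omega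
    rw [h1, h2]
    split_ifs <;> first | rfl | omega

theorem sum_range_mul_eq (m : ℕ) (f : ℕ → ℝ) :
    ∑ l ∈ Finset.range (19 * m), f l =
      ∑ r ∈ Finset.range 19, ∑ i ∈ Finset.range m, f (19 * i + r) := by
  rw [Finset.sum_comm]
  induction m with
  | zero => simp
  | succ m ih => rw [mul_add, mul_one, Finset.sum_range_add, ih,
      Finset.sum_range_succ (n := m)]

theorem sum_ite_lt {m a : ℕ} (ha : a ≤ m) :
    ∑ i ∈ Finset.range m, (if i < a then (1 : ℝ) else 0) = a := by
  rw [Finset.sum_ite, Finset.sum_const_zero, add_zero, Finset.sum_const, nsmul_one]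
  congr 1
  rw [show {i ∈ Finset.range m | i < a} = Finset.range a by ext i; simp; omega, Finset.card_range]

theorem sum_ite_sub_le {m a : ℕ} (ha : a ≤ m) :
    ∑ i ∈ Finset.range m, (if m - a ≤ i then (1 : ℝ) else 0) = a := by
  rw [Finset.sum_ite, Finset.sum_const_zero, add_zero, Finset.sum_const, nsmul_one]
  congr 1
  rw [show {i ∈ Finset.range m | m - a ≤ i} = Finset.Ico (m - a) m by ext i; simp; omega,
    Nat.card_Ico]
  omega

theorem sum_nearOptimal_mul {m a : ℕ} (ha : a ≤ m) (F : ℕ → ℝ)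
    (hF : ∀ r, 1 ≤ r → r ≤ 6 → F (19 - r) = F r) :
    ∑ l ∈ Finset.range (19 * m), nearOptimal m a l * F (l % 19) =
      m * (F 0 + 2 * ∑ r ∈ Finset.Icc 1 5, F r) + 2 * (a * F 6) := by
  have hmod : ∀ r < 19, ∀ i, (19 * i + r) % 19 = r := fun r hr i => by omega
  have hdiv : ∀ r < 19, ∀ i, (19 * i + r) / 19 = i := fun r hr i => by omega
  have h1 : ∀ r < 19, ∑ i ∈ Finset.range m, nearOptimal m a (19 * i + r) * F ((19 * i + r) % 19) =
      (if r = 6 ∨ r = 13 then (a : ℝ) else if 7 ≤ r ∧ r ≤ 12 then 0 else m) * F r := by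
    intro r hr
    simp only [nearOptimal, hmod r hr, hdiv r hr, ← Finset.sum_mul]
    congr 1
    by_cases h6 : r = 6
    · simp [h6, sum_ite_lt ha]
    by_cases h13 : r = 13
    · simpa only [h13, if_true, if_false, or_true, show ¬ (13 = 6) by norm_num] using
        sum_ite_sub_le ha
    · by_cases h7 : 7 ≤ r ∧ r ≤ 12 <;> simp [h6, h13, h7]
  rw [sum_range_mul_eq, Finset.sum_congr rfl fun r hr => h1 r (Finset.mem_range.1 hr)]
  have e13 : F 13 = F 6 := hF 6 (by norm_num) (by norm_num)
  have e14 : F 14 = F 5 := hF 5 (by norm_num) (by norm_num)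
  have e15 : F 15 = F 4 := hF 4 (by norm_num) (by norm_num)
  have e16 : F 16 = F 3 := hF 3 (by norm_num) (by norm_num)
  have e17 : F 17 = F 2 := hF 2 (by norm_num) (by norm_num)
  have e18 : F 18 = F 1 := hF 1 (by norm_num) (by norm_num)
  simp [Finset.sum_range_succ, Finset.sum_Icc_succ_top, e13, e14, e15, e16, e17, e18]
  ring

theorem cos_nineteen_mod (q l : ℕ) :
    Real.cos (2 * Real.pi * (q * (l % 19) : ℕ) / 19) = Real.cos (2 * Real.pi * (q * l : ℕ) / 19) := by
  have h : (l : ℝ) = (l % 19 : ℕ) + 19 * (l / 19 : ℕ) := by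
    exact_mod_cast (Nat.mod_add_div l 19).symm
  rw [← Real.cos_add_nat_mul_two_pi (2 * Real.pi * (q * (l % 19) : ℕ) / 19) (q * (l / 19))]
  congr 1
  push_cast
  rw [h]; ring

theorem cos_nineteen_reflect (q r : ℕ) (hr : r ≤ 19) :
    Real.cos (2 * Real.pi * (q * (19 - r) : ℕ) / 19) = Real.cos (2 * Real.pi * (q * r : ℕ) / 19) := by
  rw [← Real.cos_nat_mul_two_pi_sub (2 * Real.pi * (q * r : ℕ) / 19) q]
  congr 1
  push_cast [Nat.cast_sub hr]
  ring

/-- The sum of `cos (2πqr/19)` over `|r| ≤ 6`. -/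
noncomputable def dirichletNineteen (q : ℕ) : ℝ :=
  1 + 2 * ∑ r ∈ Finset.Icc 1 6, Real.cos (2 * Real.pi * (q * r : ℕ) / 19)

theorem sin_mul_dirichletNineteen (q : ℕ) :
    Real.sin (Real.pi * q / 19) * dirichletNineteen q = Real.sin (13 * Real.pi * q / 19) := by
  have h := sin_mul_dirichlet_sum (2 * Real.pi * q / 19) 6
  have e1 : 2 * Real.pi * q / 19 / 2 = Real.pi * q / 19 := by ring
  have e2 : ((6 : ℕ) + 1 / 2 : ℝ) * (2 * Real.pi * q / 19) = 13 * Real.pi * q / 19 := by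
    push_cast; ring
  rw [e1, e2] at h
  rw [← h, dirichletNineteen]
  congr 3
  rw [Finset.range_eq_Ico, Finset.sum_Ico_add' (fun i : ℕ => Real.cos (i * (2 * Real.pi * q / 19)))]
  refine Finset.sum_congr rfl fun r _ => ?_
  congr 1; push_cast; ring

theorem dirichletNineteen_le {q : ℕ} (h2 : 2 ≤ q) (h17 : q ≤ 17) : dirichletNineteen q ≤ 4 := by
  have hpi1 := Real.pi_gt_d4
  have hpi2 := Real.pi_lt_d4
  have hmono : ∀ i : ℕ, 2 ≤ i → 2 * i ≤ 19 → 1 / 4 ≤ Real.sin (Real.pi * i / 19) := by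
    intro i hi hi'
    have h1 : (2 : ℝ) ≤ i := by exact_mod_cast hi
    have h2 : (2 * i : ℝ) ≤ 19 := by exact_mod_cast hi'
    have hs : Real.sin (Real.pi * 2 / 19) ≤ Real.sin (Real.pi * i / 19) := by
      refine Real.sin_le_sin_of_le_of_le_pi_div_two (by linarith) ?_ (by gcongr)
      rw [div_le_div_iff₀ (by norm_num) (by norm_num)]
      nlinarith
    refine le_trans ?_ hs
    have := Real.sin_ge_sub_cube (x := Real.pi * 2 / 19) (by positivity)
    have h3 : (Real.pi * 2 / 19) ^ 3 ≤ (1 / 3) ^ 3 :=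
      pow_le_pow_left₀ (by positivity) (by linarith) 3
    linarith
  have hs : 1 / 4 ≤ Real.sin (Real.pi * q / 19) := by
    rcases le_or_gt (2 * q) 19 with h | h
    · exact hmono q h2 h
    · have := hmono (19 - q) (by omega) (by omega)
      rw [Nat.cast_sub (by omega)] at this
      rwa [show Real.pi * ((19 : ℕ) - q : ℝ) / 19 = Real.pi - Real.pi * q / 19 by
        push_cast; ring, Real.sin_pi_sub] at this
  by_contra hlt
  have h1 := sin_mul_dirichletNineteen q
  have h3 := Real.sin_le_one (13 * Real.pi * q / 19)
  nlinarith [not_le.1 hlt]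

theorem four_lt_dirichletNineteen_one : 4 < dirichletNineteen 1 := by
  have h := fun r (hr : r ≤ 19) => (abs_le.1 (abs_cos_sub_cosApprox_le (n := 19) (by norm_num) hr)).1
  have h1 := h 1 (by norm_num)
  have h2 := h 2 (by norm_num)
  have h3 := h 3 (by norm_num)
  have h4 := h 4 (by norm_num)
  have h5 := h 5 (by norm_num)
  have h6 := h 6 (by norm_num)
  have hq : ((5 : ℚ) : ℝ) ≤ (1 + 2 * (cosApprox 19 1 + cosApprox 19 2 + cosApprox 19 3 +
      cosApprox 19 4 + cosApprox 19 5 + cosApprox 19 6) : ℚ) := Rat.cast_le.2 (by decide +kernel)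
  push_cast at hq h1 h2 h3 h4 h5 h6
  simp only [dirichletNineteen, Finset.sum_Icc_succ_top, Nat.one_le_ofNat, Finset.Icc_self,
    Finset.sum_singleton, Nat.reduceAdd, one_mul]
  push_cast
  linarith

theorem dirichletNineteen_eighteen : dirichletNineteen 18 = dirichletNineteen 1 := by
  rw [dirichletNineteen, dirichletNineteen]
  congr 2
  refine Finset.sum_congr rfl fun r hr => ?_
  rw [← Real.cos_nat_mul_two_pi_sub _ r]
  congr 1
  push_cast; ring

/-- The eigenvalue condition for the full classes `|r| ≤ 6` and the frequencies other than
`k = m` and `k = 18m`. -/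
theorem dirichletNineteen_add_lt {s : ℕ} (h2 : 2 ≤ s) (h17 : s ≤ 17) :
    dirichletNineteen (s + 1) + dirichletNineteen (s - 1) < 2 * dirichletNineteen 1 := by
  have h1 := four_lt_dirichletNineteen_one
  rcases h2.eq_or_lt with rfl | h2
  · have := dirichletNineteen_le (q := 3) (by norm_num) (by norm_num)
    norm_num; linarith
  rcases h17.eq_or_lt with rfl | h17
  · have := dirichletNineteen_le (q := 16) (by norm_num) (by norm_num)
    have := dirichletNineteen_eighteen
    norm_num; linarith
  have := dirichletNineteen_le (q := s + 1) (by omega) (by omega)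
  have := dirichletNineteen_le (q := s - 1) (by omega) (by omega)
  linarith

/-- A full residue class modulo `19` has no Fourier coefficient at a frequency `k` that is not a
multiple of `m`. -/
theorem sum_cos_residue_eq_zero {m k : ℕ} (hm : 0 < m) (hk : ¬ m ∣ k) (r : ℕ) :
    ∑ i ∈ Finset.range m,
      Real.cos (2 * Real.pi * k * (19 * i + r : ℕ) / (19 * m : ℕ)) = 0 := by
  have hm0 : (m : ℝ) ≠ 0 := by exact_mod_cast hm.ne'
  have h := two_mul_sin_mul_sum_cos (2 * Real.pi * k * r / (19 * m)) (2 * Real.pi * k / m) m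
  have e1 : 2 * Real.pi * k * r / (19 * m) + m * (2 * Real.pi * k / m) - 2 * Real.pi * k / m / 2 =
      2 * Real.pi * k * r / (19 * m) - 2 * Real.pi * k / m / 2 + k * (2 * Real.pi) := by
    field_simp
    ring
  rw [e1, Real.sin_add_nat_mul_two_pi, sub_self] at h
  have hs : Real.sin (2 * Real.pi * k / m / 2) ≠ 0 := by
    intro h0
    obtain ⟨j, hj⟩ := Real.sin_eq_zero_iff.1 h0
    refine hk ?_
    have : (j : ℝ) * m = k := by
      have hpi := Real.pi_ne_zero
      field_simp at hj
      linarith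
    have hz : j * (m : ℤ) = k := by exact_mod_cast this
    exact Int.natCast_dvd_natCast.1 ⟨j, by rw [← hz, mul_comm]⟩
  have h' := (mul_eq_zero.1 h).resolve_left (mul_ne_zero two_ne_zero hs)
  rw [← h']
  refine Finset.sum_congr rfl fun i _ => ?_
  congr 1
  push_cast
  field_simp
  ring

theorem twistedL_nineteen {m : ℕ} (hm : 0 < m) (k l : ℕ) :
    twistedL (19 * m) m k l = Real.cos (2 * Real.pi * (1 * (l % 19) : ℕ) / 19) *
      (-1 + Real.cos (2 * Real.pi * k * l / (19 * m : ℕ))) := by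
  have hm0 : (m : ℝ) ≠ 0 := by exact_mod_cast hm.ne'
  rw [twistedL, cos_nineteen_mod]
  congr 2
  push_cast
  field_simp

theorem twistedL_nineteen_mul {m : ℕ} (hm : 0 < m) (s l : ℕ) :
    twistedL (19 * m) m (s * m) l = Real.cos (2 * Real.pi * (1 * (l % 19) : ℕ) / 19) *
      (-1 + Real.cos (2 * Real.pi * (s * (l % 19) : ℕ) / 19)) := by
  have hm0 : (m : ℝ) ≠ 0 := by exact_mod_cast hm.ne'
  rw [twistedL_nineteen hm, cos_nineteen_mod s]
  congr 3
  push_cast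
  field_simp

theorem cos_six_neg : Real.cos (2 * Real.pi * (1 * 6 : ℕ) / 19) ≤ 0 := by
  refine Real.cos_nonpos_of_pi_div_two_le_of_le ?_ ?_ <;> push_cast <;> linarith [Real.pi_pos]

theorem nearOptimal_full_eigenvalue_neg {m k : ℕ} (hk : 1 ≤ k) (hkm : k ≤ 19 * m - 1)
    (h1 : k ≠ m) (h18 : k ≠ 18 * m) :
    ∑ l ∈ Finset.range (19 * m), nearOptimal m m l * twistedL (19 * m) m k l < 0 := by
  have hm : 0 < m := by omega
  have hm0 : (0 : ℝ) < m := by exact_mod_cast hm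
  have hD := four_lt_dirichletNineteen_one
  have hsplit : ∀ f : ℕ → ℝ, ∑ r ∈ Finset.Icc 1 6, f r = ∑ r ∈ Finset.Icc 1 5, f r + f 6 :=
    fun f => Finset.sum_Icc_succ_top (by norm_num) f
  have hrefl := fun q r (hr : r ≤ 6) => cos_nineteen_reflect q r (by omega)
  by_cases hdvd : m ∣ k
  · obtain ⟨s, rfl⟩ := hdvd
    have hs2 : 2 ≤ s := by
      by_contra hlt
      interval_cases s <;> omega
    have hs17 : s ≤ 17 := by
      have : s < 19 := by
        by_contra hlt
        have := Nat.mul_le_mul_left m (not_lt.1 hlt)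
        omega
      by_contra hlt
      interval_cases s; omega
    simp only [mul_comm m s, twistedL_nineteen_mul hm]
    rw [sum_nearOptimal_mul le_rfl (fun r => Real.cos (2 * Real.pi * (1 * r : ℕ) / 19) *
      (-1 + Real.cos (2 * Real.pi * (s * r : ℕ) / 19)))
      (fun r hr hr' => by simp only [hrefl _ r hr'])]
    have hprod : ∀ r : ℕ, Real.cos (2 * Real.pi * (1 * r : ℕ) / 19) *
        (-1 + Real.cos (2 * Real.pi * (s * r : ℕ) / 19)) =
        1 / 2 * Real.cos (2 * Real.pi * ((s + 1) * r : ℕ) / 19) +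
        1 / 2 * Real.cos (2 * Real.pi * ((s - 1) * r : ℕ) / 19) -
          Real.cos (2 * Real.pi * (1 * r : ℕ) / 19) := by
      intro r
      have e1 : 2 * Real.pi * ((s + 1) * r : ℕ) / 19 =
          2 * Real.pi * (s * r : ℕ) / 19 + 2 * Real.pi * (1 * r : ℕ) / 19 := by push_cast; ring
      have e2 : 2 * Real.pi * ((s - 1) * r : ℕ) / 19 =
          2 * Real.pi * (s * r : ℕ) / 19 - 2 * Real.pi * (1 * r : ℕ) / 19 := by
        push_cast [Nat.cast_sub (by omega : 1 ≤ s)]; ring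
      rw [e1, e2, Real.cos_add, Real.cos_sub]; ring
    have hlt := dirichletNineteen_add_lt hs2 hs17
    simp only [dirichletNineteen, hsplit] at hlt
    simp only [hprod, Finset.sum_sub_distrib, Finset.sum_add_distrib, ← Finset.mul_sum]
    simp only [mul_zero, Nat.cast_zero, zero_div, Real.cos_zero]
    nlinarith
  · have hw : ∀ r < 19, ∀ i < m, nearOptimal m m (19 * i + r) = nearOptimal 1 1 r := by
      intro r hr i hi
      have e1 : (19 * i + r) % 19 = r := by omega
      have e2 : (19 * i + r) / 19 = i := by omega
      simp [nearOptimal, e1, e2, hi, Nat.mod_eq_of_lt hr, Nat.div_eq_of_lt hr]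
    have hzero : ∑ l ∈ Finset.range (19 * m), nearOptimal m m l *
        (Real.cos (2 * Real.pi * (1 * (l % 19) : ℕ) / 19) *
          Real.cos (2 * Real.pi * k * l / (19 * m : ℕ))) = 0 := by
      rw [sum_range_mul_eq]
      refine Finset.sum_eq_zero fun r hr => ?_
      have hr' := Finset.mem_range.1 hr
      have e : ∀ i ∈ Finset.range m, nearOptimal m m (19 * i + r) *
        (Real.cos (2 * Real.pi * (1 * ((19 * i + r) % 19) : ℕ) / 19) *
          Real.cos (2 * Real.pi * k * (19 * i + r : ℕ) / (19 * m : ℕ))) =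
          nearOptimal 1 1 r * Real.cos (2 * Real.pi * (1 * r : ℕ) / 19) *
          Real.cos (2 * Real.pi * k * (19 * i + r : ℕ) / (19 * m : ℕ)) := by
        intro i hi
        rw [hw r hr' i (Finset.mem_range.1 hi), show (19 * i + r) % 19 = r by omega]
        ring
      rw [Finset.sum_congr rfl e, ← Finset.mul_sum, sum_cos_residue_eq_zero hm hdvd, mul_zero]
    have hmain := sum_nearOptimal_mul (m := m) le_rfl
      (fun r => Real.cos (2 * Real.pi * (1 * r : ℕ) / 19)) (fun r hr hr' => hrefl 1 r hr')
    have e : ∀ l : ℕ, nearOptimal m m l * twistedL (19 * m) m k l =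
        nearOptimal m m l * (Real.cos (2 * Real.pi * (1 * (l % 19) : ℕ) / 19) *
          Real.cos (2 * Real.pi * k * l / (19 * m : ℕ))) -
        nearOptimal m m l * Real.cos (2 * Real.pi * (1 * (l % 19) : ℕ) / 19) := by
      intro l; rw [twistedL_nineteen hm]; ring
    simp only [e, Finset.sum_sub_distrib, hzero, hmain]
    rw [dirichletNineteen, hsplit] at hD
    simp only [mul_zero, Nat.cast_zero, zero_div, Real.cos_zero]
    nlinarith

/-- Completing the classes `±6` only increases the eigenvalues, as `cos (12π/19) ≤ 0`. -/
theorem nearOptimal_mul_twistedL_le {m a : ℕ} (hm : 0 < m) (k : ℕ) {l : ℕ} (hl : l < 19 * m) :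
    nearOptimal m a l * twistedL (19 * m) m k l ≤ nearOptimal m m l * twistedL (19 * m) m k l := by
  have hdiv : l / 19 < m := by omega
  have hpos : Real.cos (2 * Real.pi * (1 * (l % 19) : ℕ) / 19) ≤ 0 →
      0 ≤ twistedL (19 * m) m k l := by
    intro h
    rw [twistedL_nineteen hm]
    exact mul_nonneg_of_nonpos_of_nonpos h
      (by linarith [Real.cos_le_one (2 * Real.pi * k * l / (19 * m : ℕ))])
  unfold nearOptimal
  by_cases h6 : l % 19 = 6
  · have := hpos (by rw [h6]; exact cos_six_neg)
    simp only [h6, if_true, if_pos hdiv]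
    split_ifs <;> linarith
  by_cases h13 : l % 19 = 13
  · have := hpos (by rw [h13, cos_nineteen_reflect 1 6 (by norm_num)]; exact cos_six_neg)
    simp only [h13, if_true, Nat.sub_self, Nat.zero_le]
    norm_num
    split_ifs <;> linarith
  · simp [h6, h13]

theorem sum_nearOptimal_mul_cost {m a : ℕ} (ha : a ≤ m) :
    ∑ l ∈ Finset.range (19 * m), nearOptimal m a l * b19 (l % 19) =
      2 * (m * ∑ r ∈ Finset.Icc 1 5, b19 r + a * b19 6) := by
  rw [sum_nearOptimal_mul ha b19 fun r _ hr => b19_sub r (by omega)]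
  simp [b19]; ring

theorem nearOptimal_isFeasible {m a : ℕ} (hm : 0 < m) (ha : (a : ℝ) < criticalFraction * m) :
    IsFeasible (19 * m) m (nearOptimal m a) := by
  have hm0 : (0 : ℝ) < m := by exact_mod_cast hm
  have ham : a ≤ m := by
    have : (a : ℝ) ≤ m := by nlinarith [criticalFraction_bounds.2]
    exact_mod_cast this
  refine ⟨fun l _ => nearOptimal_eq_zero_or_one m a l, fun k hk => ?_, fun l hl => ?_⟩
  · rw [Finset.mem_Icc] at hk
    have e := sum_range_eq_add_sum_Icc (N := 19 * m) (by omega)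
      (fun l => nearOptimal m a l * twistedL (19 * m) m k l)
    have h0 : nearOptimal m a 0 * twistedL (19 * m) m k 0 = 0 := by simp [twistedL]
    rw [h0, zero_add] at e
    simp only [mul_comm (twistedL _ _ _ _), ← e]
    -- at these two frequencies the eigenvalue is the sum of the costs
    by_cases hbind : k = m ∨ k = 18 * m
    · have hb : ∀ l, twistedL (19 * m) m k l = b19 (l % 19) := by
        intro l
        have h18 : Real.cos (2 * Real.pi * (18 * (l % 19) : ℕ) / 19) =
            Real.cos (2 * Real.pi * (1 * (l % 19) : ℕ) / 19) := by
          rw [← Real.cos_nat_mul_two_pi_sub _ (l % 19)]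
          congr 1; push_cast; ring
        rcases hbind with h | h
        · have := twistedL_nineteen_mul hm 1 l
          rw [one_mul m, ← h] at this
          rw [← h, this, b19, one_mul]; ring
        · have := twistedL_nineteen_mul hm 18 l
          rw [h, this, h18, b19, one_mul]; ring
      simp only [hb]
      rw [sum_nearOptimal_mul_cost ham]
      rw [criticalFraction, div_mul_eq_mul_div, lt_div_iff₀ b19_six_pos] at ha
      linarith
    · rw [not_or] at hbind
      exact (Finset.sum_le_sum fun l hl =>
        nearOptimal_mul_twistedL_le hm k (Finset.mem_range.1 hl)).trans_lt
        (nearOptimal_full_eigenvalue_neg hk.1 hk.2 hbind.1 hbind.2)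
  · rw [Finset.mem_Icc] at hl
    exact nearOptimal_symm ham (by omega)

theorem circulantConnectivity_nearOptimal {m a : ℕ} (hm : 0 < m) (ha : a ≤ m) :
    circulantConnectivity (19 * m) (nearOptimal m a) = (11 * m + 2 * a - 1) / (19 * m - 1) := by
  have h := sum_nearOptimal_mul ha (fun _ => 1) (fun _ _ _ => rfl)
  simp only [mul_one] at h
  rw [sum_range_eq_add_sum_Icc (by omega)] at h
  have h0 : nearOptimal m a 0 = 1 := by simp [nearOptimal]
  rw [circulantConnectivity, show ((19 * m : ℕ) : ℝ) = 19 * m by push_cast; ring]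
  congr 1
  simp at h
  linarith

/-- The maximum exists as soon as the program is feasible: the objective has finitely many values. -/
theorem exists_isMaxConnectivity {N p : ℕ} {x : ℕ → ℝ} (hx : IsFeasible N p x) :
    ∃ μ, IsMaxConnectivity N p μ ∧ circulantConnectivity N x ≤ μ := by
  have hne : {c : ℝ | ∃ x : ℕ → ℝ, IsFeasible N p x ∧ c = circulantConnectivity N x}.Nonempty :=
    ⟨_, x, hx, rfl⟩
  have hfin : {c : ℝ | ∃ x : ℕ → ℝ, IsFeasible N p x ∧ c = circulantConnectivity N x}.Finite := by
    refine ((Finset.range (N + 1)).finite_toSet.image fun i : ℕ => (i : ℝ) / ((N : ℝ) - 1)).subset ?_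
    rintro c ⟨y, hy, rfl⟩
    have e : ∑ l ∈ Finset.Icc 1 (N - 1), y l =
        (({l ∈ Finset.Icc 1 (N - 1) | y l = 1}).card : ℝ) := by
      rw [Finset.card_filter, Nat.cast_sum]
      refine Finset.sum_congr rfl fun l hl => ?_
      rcases hy.binary l hl with h | h <;> simp [h]
    refine ⟨({l ∈ Finset.Icc 1 (N - 1) | y l = 1}).card, ?_, by
      simp only [circulantConnectivity, e]⟩
    have := Finset.card_filter_le (Finset.Icc 1 (N - 1)) (fun l => y l = 1)
    rw [Nat.card_Icc] at this
    simp only [Finset.coe_range, Set.mem_Iio]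
    omega
  exact ⟨_, ⟨hne.csSup_mem hfin, fun c hc => le_csSup hfin.bddAbove hc⟩,
    le_csSup hfin.bddAbove ⟨x, hx, rfl⟩⟩

/-- The largest number of phases of each of the classes `±6` that keeps the state stable. -/
noncomputable def criticalCount (m : ℕ) : ℕ := ⌈criticalFraction * m⌉₊ - 1

theorem criticalCount_lt {m : ℕ} (hm : 0 < m) : (criticalCount m : ℝ) < criticalFraction * m := by
  have hm0 : (0 : ℝ) < m := by exact_mod_cast hm
  have hpos : 0 < criticalFraction * m := mul_pos (by linarith [criticalFraction_bounds.1]) hm0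
  exact Nat.lt_ceil.1 (Nat.sub_lt (Nat.ceil_pos.2 hpos) one_pos)

theorem le_criticalCount (m : ℕ) : criticalFraction * m - 1 ≤ criticalCount m := by
  have h := Nat.le_ceil (criticalFraction * m)
  have h2 : ((⌈criticalFraction * m⌉₊ : ℕ) : ℝ) ≤ (criticalCount m + 1 : ℕ) := by
    exact_mod_cast (by unfold criticalCount; omega)
  push_cast at h2
  linarith

theorem exists_feasible_seq :
    ∃ x : ℕ → ℕ → ℝ, (∀ m, 1 ≤ m → IsFeasible (19 * m) m (x m)) ∧
      Tendsto (fun m => circulantConnectivity (19 * m) (x m)) atTop (𝓝 supMu) := by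
  have hmem : ∀ m, 1 ≤ m → IsFeasible (19 * m) m (nearOptimal m (criticalCount m)) :=
    fun m hm => nearOptimal_isFeasible hm (criticalCount_lt hm)
  refine ⟨fun m => nearOptimal m (criticalCount m), hmem, ?_⟩
  have hlow : ∀ᶠ m : ℕ in atTop, supMu - 1 / (m : ℝ) ≤
      circulantConnectivity (19 * m) (nearOptimal m (criticalCount m)) := by
    filter_upwards [eventually_ge_atTop 1] with m hm
    have hm0 : (1 : ℝ) ≤ m := by exact_mod_cast hm
    have h1 := criticalCount_lt hm
    have h2 := le_criticalCount m
    have ham : criticalCount m ≤ m := by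
      have : (criticalCount m : ℝ) ≤ m := by nlinarith [criticalFraction_bounds.2]
      exact_mod_cast this
    rw [circulantConnectivity_nearOptimal hm ham, le_div_iff₀ (by linarith), supMu_eq, sub_mul]
    have h3 : (1 : ℝ) / m * (19 * m - 1) = 19 - 1 / m := by field_simp
    have h4 : 1 / (m : ℝ) ≤ 1 := by rw [div_le_one (by linarith)]; exact hm0
    rw [h3]
    nlinarith [criticalFraction_bounds.1]
  have hup : ∀ᶠ m : ℕ in atTop,
      circulantConnectivity (19 * m) (nearOptimal m (criticalCount m)) ≤ supMu := by
    filter_upwards [eventually_ge_atTop 1] with m hm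
    exact circulantConnectivity_le_supMu hm (by omega) (hmem m hm)
  refine tendsto_of_tendsto_of_tendsto_of_le_of_le' ?_ tendsto_const_nhds hlow hup
  simpa using tendsto_const_nhds.sub (tendsto_one_div_atTop_nhds_zero_nat (𝕜 := ℝ))

theorem exists_maxConnectivity_seq :
    ∃ u : ℕ → ℝ, (∀ m : ℕ, 1 ≤ m → IsMaxConnectivity (19 * m) m (u m)) ∧
      Tendsto u atTop (𝓝 supMu) := by
  obtain ⟨x, hx, hlim⟩ := exists_feasible_seq
  have h : ∀ m, ∃ μ, 1 ≤ m → IsMaxConnectivity (19 * m) m μ ∧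
      circulantConnectivity (19 * m) (x m) ≤ μ := by
    intro m
    by_cases hm : 1 ≤ m
    · obtain ⟨μ, hμ⟩ := exists_isMaxConnectivity (hx m hm)
      exact ⟨μ, fun _ => hμ⟩
    · exact ⟨0, fun h => absurd h hm⟩
  choose u hu using h
  refine ⟨u, fun m hm => (hu m hm).1, ?_⟩
  refine tendsto_of_tendsto_of_tendsto_of_le_of_le' hlim tendsto_const_nhds ?_ ?_
  · filter_upwards [eventually_ge_atTop 1] with m hm using (hu m hm).2
  · filter_upwards [eventually_ge_atTop 1] with m hm
    obtain ⟨y, hy, e⟩ := (hu m hm).1.1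
    rw [e]
    exact circulantConnectivity_le_supMu hm (by omega) hy

theorem isLUB_supMu :
    IsLUB {μ : ℝ | ∃ N p : ℕ, 2 ≤ N ∧ 1 ≤ p ∧ p ≤ N / 2 ∧ IsMaxConnectivity N p μ} supMu := by
  constructor
  · rintro μ ⟨N, p, -, hp, hpN, ⟨x, hx, rfl⟩, -⟩
    exact circulantConnectivity_le_supMu hp hpN hx
  · intro b hb
    obtain ⟨u, hu, hlim⟩ := exists_maxConnectivity_seq
    refine le_of_tendsto hlim ?_
    filter_upwards [eventually_ge_atTop 1] with m hm
    exact hb ⟨19 * m, m, by omega, hm, by omega, hu m hm⟩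

/-! ### The Jacobian spectrum of twisted states of circulant networks -/

open scoped Classical in
theorem phaseJacobian_mulVec {N : ℕ} (G : SimpleGraph (Fin N)) (θ v : Fin N → ℝ) (i : Fin N) :
    (phaseJacobian G θ).mulVec v i =
      ∑ j, G.adjMatrix ℝ i j * Real.cos (θ j - θ i) * (v j - v i) := by
  simp only [Matrix.mulVec, dotProduct, phaseJacobian, Matrix.of_apply, mul_sub,
    Finset.sum_sub_distrib, ← Finset.sum_mul]
  have h : ∀ j, (if i = j then -∑ k, G.adjMatrix ℝ i k * Real.cos (θ k - θ i)
      else G.adjMatrix ℝ i j * Real.cos (θ j - θ i)) * v j =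
      G.adjMatrix ℝ i j * Real.cos (θ j - θ i) * v j -
        if i = j then (∑ k, G.adjMatrix ℝ i k * Real.cos (θ k - θ i)) * v j else 0 := by
    intro j
    by_cases hij : i = j
    · subst hij; simp
    · simp [hij]
  simp only [h, Finset.sum_sub_distrib, Finset.sum_ite_eq, Finset.mem_univ, if_true]

theorem re_stdAddChar {N : ℕ} [NeZero N] (l k : ZMod N) :
    (ZMod.stdAddChar (l * k)).re = Real.cos (2 * Real.pi * k.val * l.val / N) := by
  have e : l * k = (((l.val * k.val : ℕ) : ℤ) : ZMod N) := by simp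
  rw [e, ZMod.stdAddChar_coe]
  have e2 : 2 * (Real.pi : ℂ) * Complex.I * (((l.val * k.val : ℕ) : ℤ) : ℂ) / (N : ℂ) =
      ((2 * Real.pi * k.val * l.val / N : ℝ) : ℂ) * Complex.I := by
    push_cast; ring
  rw [e2, Complex.exp_ofReal_mul_I_re]

/-- The discrete Fourier transform diagonalizes the operator `v ↦ ∑ₗ w(l) (v(· + l) - v)`; an
eigenvector that is not constant has a nonzero Fourier coefficient at some `k ≠ 0`. -/
theorem eigenvalue_neg_of_circulant {N : ℕ} [NeZero N] (w v : ZMod N → ℝ) (lam : ℝ)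
    (hw : ∀ k : ZMod N, k ≠ 0 →
      ∑ l, w l * (Real.cos (2 * Real.pi * k.val * l.val / N) - 1) < 0)
    (hv : ∀ i, ∑ l, w l * (v (i + l) - v i) = lam * v i) (hc : ¬ ∃ c : ℝ, v = fun _ => c) :
    lam < 0 := by
  set Φ : ZMod N → ℂ := fun i => (v i : ℂ) with hΦ
  obtain ⟨k, hk0, hk⟩ : ∃ k : ZMod N, k ≠ 0 ∧ ZMod.dft Φ k ≠ 0 := by
    by_contra hcon
    push Not at hcon
    refine hc ⟨v 0, ?_⟩
    have h : ∀ j, (N : ℂ) * Φ (-j) = ZMod.dft Φ 0 := by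
      intro j
      have h1 := congrFun (ZMod.dft_dft Φ) j
      rw [ZMod.dft_apply, Finset.sum_eq_single 0 (fun b _ hb => by rw [hcon b hb, smul_zero])
        (fun h => absurd (Finset.mem_univ _) h)] at h1
      simpa using h1.symm
    funext j
    have h1 := (h (-j)).trans (h 0).symm
    rw [neg_neg, neg_zero] at h1
    have hN : (N : ℂ) ≠ 0 := by exact_mod_cast NeZero.ne N
    exact Complex.ofReal_injective (mul_left_cancel₀ hN h1)
  have hshift : ∀ l, ∑ i, ZMod.stdAddChar (-(i * k)) * Φ (i + l) =
      ZMod.stdAddChar (l * k) * ZMod.dft Φ k := by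
    intro l
    rw [ZMod.dft_apply, Finset.mul_sum]
    refine Fintype.sum_equiv (Equiv.addRight l) _ _ fun i => ?_
    simp only [Equiv.coe_addRight, smul_eq_mul]
    rw [← mul_assoc, ← AddChar.map_add_eq_mul]
    congr 2; ring
  have hmain : (∑ l, (w l : ℂ) * (ZMod.stdAddChar (l * k) - 1)) * ZMod.dft Φ k =
      lam * ZMod.dft Φ k := by
    calc _ = ∑ l, (w l : ℂ) * (∑ i, ZMod.stdAddChar (-(i * k)) * Φ (i + l) -
          ∑ i, ZMod.stdAddChar (-(i * k)) * Φ i) := by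
          rw [Finset.sum_mul]
          refine Finset.sum_congr rfl fun l _ => ?_
          rw [hshift, ZMod.dft_apply]
          simp only [smul_eq_mul]
          ring
      _ = ∑ i, ZMod.stdAddChar (-(i * k)) * ((∑ l, w l * (v (i + l) - v i) : ℝ) : ℂ) := by
          simp only [← Finset.sum_sub_distrib, Finset.mul_sum, Complex.ofReal_sum]
          rw [Finset.sum_comm]
          refine Finset.sum_congr rfl fun i _ => Finset.sum_congr rfl fun l _ => ?_
          simp only [hΦ]; push_cast; ring
      _ = _ := by
          rw [ZMod.dft_apply, Finset.mul_sum]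
          refine Finset.sum_congr rfl fun i _ => ?_
          rw [hv, smul_eq_mul]; push_cast; ring
  have h := congrArg Complex.re (mul_right_cancel₀ hk hmain)
  rw [Complex.ofReal_re, Complex.re_sum] at h
  rw [← h]
  refine lt_of_eq_of_lt (Finset.sum_congr rfl fun l _ => ?_) (hw k hk0)
  rw [Complex.re_ofReal_mul, Complex.sub_re, Complex.one_re, re_stdAddChar]

/-- The circulant network in which `i` and `j ≠ i` are adjacent when `x_l = 1` for the residue `l`
of `j - i`. The vertex type `Fin (n + 1)` is `ZMod (n + 1)` by definition. -/
def circulantNetwork {n : ℕ} {x : ℕ → ℝ} (hx : ∀ l ∈ Finset.Icc 1 n, x l = x (n + 1 - l)) :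
    SimpleGraph (ZMod (n + 1)) where
  Adj i j := i ≠ j ∧ x (j - i).val = 1
  symm := ⟨by
    rintro i j ⟨hij, h⟩
    refine ⟨hij.symm, ?_⟩
    have h0 : j - i ≠ 0 := sub_ne_zero.2 hij.symm
    have h1 : (j - i).val ≠ 0 := by rwa [Ne, ZMod.val_eq_zero]
    have h2 := ZMod.val_lt (j - i)
    rw [← neg_sub j i, ZMod.neg_val, if_neg h0, ← hx _ (Finset.mem_Icc.2 ⟨by omega, by omega⟩), h]⟩
  loopless := ⟨fun i h => h.1 rfl⟩

/-- The weight `x_l` of the residue class `l`, with weight zero for `l = 0`. -/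
def residueWeight {n : ℕ} (x : ℕ → ℝ) (l : ZMod (n + 1)) : ℝ := if l = 0 then 0 else x l.val

/-- The phases `θ_j = 2πpj/(n+1)` of the `p`-twisted state. -/
noncomputable def twistedState (n p : ℕ) (j : ZMod (n + 1)) : ℝ :=
  2 * Real.pi * p * j.val / (n + 1 : ℕ)

/-- Phase differences of the twisted state depend, modulo `2π`, on the index difference only. -/
theorem twistedState_sub (n p : ℕ) (i j : ZMod (n + 1)) :
    ∃ z : ℤ, twistedState n p j - twistedState n p i =
      twistedState n p (j - i) + z * (2 * Real.pi) := by
  have h : (((j.val - i.val - (j - i).val : ℤ)) : ZMod (n + 1)) = 0 := by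
    push_cast
    simp
  obtain ⟨z, hz⟩ := (ZMod.intCast_zmod_eq_zero_iff_dvd _ (n + 1)).1 h
  refine ⟨p * z, ?_⟩
  have hz' : (j.val : ℝ) - i.val - (j - i).val = (n + 1 : ℕ) * z := by exact_mod_cast hz
  have hn : ((n + 1 : ℕ) : ℝ) ≠ 0 := by positivity
  simp only [twistedState]
  field_simp
  push_cast at hz' ⊢
  linear_combination p * hz'

theorem sin_twistedState_sub (n p : ℕ) (i j : ZMod (n + 1)) :
    Real.sin (twistedState n p j - twistedState n p i) = Real.sin (twistedState n p (j - i)) := by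
  obtain ⟨z, hz⟩ := twistedState_sub n p i j
  rw [hz, Real.sin_add_int_mul_two_pi]

theorem cos_twistedState_sub (n p : ℕ) (i j : ZMod (n + 1)) :
    Real.cos (twistedState n p j - twistedState n p i) = Real.cos (twistedState n p (j - i)) := by
  obtain ⟨z, hz⟩ := twistedState_sub n p i j
  rw [hz, Real.cos_add_int_mul_two_pi]

theorem sum_zmod_eq_sum_Icc (n : ℕ) (f : ℕ → ℝ) (hf : f 0 = 0) :
    ∑ l : ZMod (n + 1), f l.val = ∑ l ∈ Finset.Icc 1 n, f l := by
  have h : ∑ l : ZMod (n + 1), f l.val = ∑ l ∈ Finset.range (n + 1), f l :=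
    Fin.sum_univ_eq_sum_range f (n + 1)
  rw [h, sum_range_eq_add_sum_Icc (by omega), hf, zero_add, Nat.add_sub_cancel]

open scoped Classical in
theorem div_le_connectivity {N : ℕ} (hN : 1 ≤ N) (G : SimpleGraph (Fin N)) {d : ℝ}
    (hd : ∀ i, d ≤ ∑ j, G.adjMatrix ℝ i j) : d / ((N : ℝ) - 1) ≤ connectivity G := by
  have : Nonempty (Fin N) := ⟨⟨0, hN⟩⟩
  obtain ⟨i, hi⟩ := G.exists_minimal_degree_vertex
  have h1 : (G.degree i : ℝ) = ∑ j, G.adjMatrix ℝ i j := by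
    simp only [SimpleGraph.adjMatrix_apply, Finset.sum_boole]
    rw [← SimpleGraph.card_neighborFinset_eq_degree, SimpleGraph.neighborFinset_eq_filter]
  have h2 : (1 : ℝ) ≤ N := by exact_mod_cast hN
  rw [connectivity, hi, h1]
  exact div_le_div_of_nonneg_right (hd i) (by linarith)

section

variable {n p : ℕ} {x : ℕ → ℝ}

theorem residueWeight_neg (hx : IsFeasible (n + 1) p x) (l : ZMod (n + 1)) :
    residueWeight x (-l) = residueWeight x l := by
  unfold residueWeight
  by_cases h : l = 0
  · simp [h]
  · have h1 : l.val ≠ 0 := by rwa [Ne, ZMod.val_eq_zero]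
    have h2 := ZMod.val_lt l
    rw [if_neg h, if_neg (neg_ne_zero.2 h), ZMod.neg_val, if_neg h,
      ← hx.symm _ (Finset.mem_Icc.2 ⟨by omega, by omega⟩)]

open scoped Classical in
theorem adjMatrix_circulantNetwork (hx : IsFeasible (n + 1) p x) (i j : ZMod (n + 1)) :
    (circulantNetwork hx.symm).adjMatrix ℝ i j = residueWeight x (j - i) := by
  rw [SimpleGraph.adjMatrix_apply, residueWeight]
  by_cases h : j - i = 0
  · rw [if_pos h, if_neg]
    rintro ⟨h1, -⟩
    exact h1 (sub_eq_zero.1 h).symm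
  · have h1 : (j - i).val ≠ 0 := by rwa [Ne, ZMod.val_eq_zero]
    have h2 := ZMod.val_lt (j - i)
    rw [if_neg h]
    rcases hx.binary (j - i).val (Finset.mem_Icc.2 ⟨by omega, by omega⟩) with h3 | h3
    · rw [h3, if_neg]
      rintro ⟨-, h4⟩
      rw [h3] at h4; exact zero_ne_one h4
    · rw [h3, if_pos]
      exact ⟨fun e => h (sub_eq_zero.2 e.symm), h3⟩

theorem phaseField_circulantNetwork (hx : IsFeasible (n + 1) p x) (i : ZMod (n + 1)) :
    phaseField (N := n + 1) (circulantNetwork hx.symm) (twistedState n p) i = 0 := by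
  classical
  have h1 : phaseField (N := n + 1) (circulantNetwork hx.symm) (twistedState n p) i =
      ∑ j : ZMod (n + 1), residueWeight x (j - i) * Real.sin (twistedState n p (j - i)) := by
    exact Finset.sum_congr rfl fun j _ =>
      congrArg₂ (· * ·) (adjMatrix_circulantNetwork hx i j) (sin_twistedState_sub n p i j)
  have h2 : ∑ j : ZMod (n + 1), residueWeight x (j - i) * Real.sin (twistedState n p (j - i)) =
      ∑ l : ZMod (n + 1), residueWeight x l * Real.sin (twistedState n p l) :=
    Fintype.sum_equiv (Equiv.subRight i) _ _ fun j => rfl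
  have h3 : ∑ l : ZMod (n + 1), residueWeight x l * Real.sin (twistedState n p l) =
      -∑ l : ZMod (n + 1), residueWeight x l * Real.sin (twistedState n p l) := by
    rw [← Finset.sum_neg_distrib]
    refine Fintype.sum_equiv (Equiv.neg _) _ _ fun l => ?_
    have h := sin_twistedState_sub n p l 0
    have h0 : twistedState n p 0 = 0 := by simp [twistedState]
    rw [h0, zero_sub, zero_sub, Real.sin_neg] at h
    rw [Equiv.neg_apply, residueWeight_neg hx, ← h]
    ring
  rw [h1, h2]
  linarith

theorem jacobian_circulantNetwork_neg (hx : IsFeasible (n + 1) p x) (lam : ℝ)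
    (v : Fin (n + 1) → ℝ)
    (hv : (phaseJacobian (N := n + 1) (circulantNetwork hx.symm) (twistedState n p)).mulVec v =
      lam • v)
    (hc : ¬ ∃ c : ℝ, v = fun _ => c) : lam < 0 := by
  classical
  refine eigenvalue_neg_of_circulant (N := n + 1)
    (fun l => residueWeight x l * Real.cos (twistedState n p l)) v lam (fun k hk => ?_)
    (fun i => ?_) hc
  · have h1 : k.val ≠ 0 := by rwa [Ne, ZMod.val_eq_zero]
    have h2 := ZMod.val_lt k
    have h3 := hx.stable k.val (Finset.mem_Icc.2 ⟨by omega, by omega⟩)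
    rw [Nat.add_sub_cancel, ← sum_zmod_eq_sum_Icc n (fun l => twistedL (n + 1) p k.val l * x l)
      (by simp [twistedL])] at h3
    refine lt_of_eq_of_lt (Finset.sum_congr rfl fun l _ => ?_) h3
    simp only [residueWeight, twistedState, twistedL]
    by_cases hl : l = 0
    · simp [hl]
    · rw [if_neg hl]; ring
  · refine Eq.trans ?_ ((phaseJacobian_mulVec (N := n + 1) (circulantNetwork hx.symm)
      (twistedState n p) v i).symm.trans (congrFun hv i))
    refine Fintype.sum_equiv (Equiv.addLeft i) _ _ fun l => ?_
    have h2 := adjMatrix_circulantNetwork hx i (i + l)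
    have h3 := cos_twistedState_sub n p i (i + l)
    rw [add_sub_cancel_left] at h2 h3
    rw [← h2, ← h3]
    rfl

theorem circulantConnectivity_le_connectivity (hx : IsFeasible (n + 1) p x) :
    circulantConnectivity (n + 1) x ≤ connectivity (N := n + 1) (circulantNetwork hx.symm) := by
  classical
  refine div_le_connectivity (N := n + 1) (by omega) _ fun (i : ZMod (n + 1)) => ?_
  have h1 : ∑ j : ZMod (n + 1), residueWeight x (j - i) = ∑ l : ZMod (n + 1), residueWeight x l :=
    Fintype.sum_equiv (Equiv.subRight i) _ _ fun j => rfl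
  have h2 := sum_zmod_eq_sum_Icc n (fun l => if l = 0 then 0 else x l) (by simp)
  have h3 : ∑ l ∈ Finset.Icc 1 n, (if l = 0 then 0 else x l) = ∑ l ∈ Finset.Icc 1 n, x l :=
    Finset.sum_congr rfl fun l hl => if_neg (by have := (Finset.mem_Icc.1 hl).1; omega)
  rw [Nat.add_sub_cancel, ← h3, ← h2]
  refine le_of_eq (Eq.trans ?_ (h1.symm.trans (Finset.sum_congr rfl fun j _ =>
    (adjMatrix_circulantNetwork hx i j).symm)))
  refine Finset.sum_congr rfl fun l _ => ?_
  simp only [residueWeight, ZMod.val_eq_zero]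

end

theorem twistedState_not_isInPhase {n p : ℕ} (hp : 1 ≤ p) (hpn : p ≤ (n + 1) / 2) :
    ¬ IsInPhase (N := n + 1) (twistedState n p) := by
  intro h
  have h1 := h (1 : ZMod (n + 1)) (0 : ZMod (n + 1))
  have hn : 1 < n + 1 := by omega
  have : Fact (1 < n + 1) := ⟨hn⟩
  have e1 : twistedState n p (1 : ZMod (n + 1)) = 2 * Real.pi * p / (n + 1 : ℕ) := by
    simp [twistedState, ZMod.val_one]
  have e0 : twistedState n p (0 : ZMod (n + 1)) = 0 := by simp [twistedState]
  have h2 := congrArg Real.Angle.cos h1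
  rw [Real.Angle.cos_coe, Real.Angle.cos_coe, e1, e0, Real.cos_zero] at h2
  have hn0 : (0 : ℝ) < (n + 1 : ℕ) := by positivity
  have hp0 : (1 : ℝ) ≤ p := by exact_mod_cast hp
  have hpn0 : (2 * p : ℝ) ≤ (n + 1 : ℕ) := by exact_mod_cast (by omega : 2 * p ≤ n + 1)
  have hlt : 2 * Real.pi * p / (n + 1 : ℕ) < 2 * Real.pi := by
    rw [div_lt_iff₀ hn0]; nlinarith [Real.pi_pos]
  have hpos : 0 < 2 * Real.pi * p / (n + 1 : ℕ) := by positivity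
  rw [Real.cos_eq_one_iff_of_lt_of_lt (by linarith) hlt] at h2
  exact hpos.ne' h2

/-- Feasible points of the integer program are circulant networks with a linearly stable twisted
state. -/
theorem exists_network_of_isFeasible {N p : ℕ} (hp : 1 ≤ p) (hpN : p ≤ N / 2) {x : ℕ → ℝ}
    (hx : IsFeasible N p x) :
    ∃ (G : SimpleGraph (Fin N)) (θ : Fin N → ℝ), circulantConnectivity N x ≤ connectivity G ∧
      IsLinearlyStableEquilibrium G θ ∧ ¬ IsInPhase θ := by
  obtain ⟨n, rfl⟩ : ∃ n, N = n + 1 := ⟨N - 1, by omega⟩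
  exact ⟨circulantNetwork hx.symm, twistedState n p, circulantConnectivity_le_connectivity hx,
    ⟨phaseField_circulantNetwork hx, jacobian_circulantNetwork_neg hx⟩,
    twistedState_not_isInPhase hp hpN⟩

theorem exists_network_of_lt_supMu {c : ℝ} (hc : c < supMu) :
    ∃ (N : ℕ) (_ : 2 ≤ N) (G : SimpleGraph (Fin N)) (θ : Fin N → ℝ),
      c < connectivity G ∧ IsLinearlyStableEquilibrium G θ ∧ ¬ IsInPhase θ := by
  obtain ⟨x, hx, hlim⟩ := exists_feasible_seq
  obtain ⟨m, hm, hm1⟩ := ((hlim.eventually (lt_mem_nhds hc)).and (eventually_ge_atTop 1)).exists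
  obtain ⟨G, θ, h1, h2, h3⟩ := exists_network_of_isFeasible hm1 (by omega) (hx m hm1)
  exact ⟨19 * m, by omega, G, θ, hm.trans_le h1, h2, h3⟩

/-! ### Linearly stable equilibria obstruct global synchronization -/

section Energy

open scoped Classical

variable {N : ℕ} (G : SimpleGraph (Fin N))

/-- The energy `-(1/2) ∑ aᵢⱼ cos(θⱼ - θᵢ)`, of which `phaseField` is the negative gradient. -/
noncomputable def phaseEnergy (θ : Fin N → ℝ) : ℝ :=
  -(1 / 2) * ∑ i, ∑ j, G.adjMatrix ℝ i j * Real.cos (θ j - θ i)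

/-- The sum of the squared differences of the coordinates. It measures the distance to the constant
vectors. -/
def spread (v : Fin N → ℝ) : ℝ := ∑ i, ∑ j, (v j - v i) ^ 2

theorem spread_nonneg (v : Fin N → ℝ) : 0 ≤ spread v :=
  Finset.sum_nonneg fun _ _ => Finset.sum_nonneg fun _ _ => sq_nonneg _

theorem sq_sub_le_spread (v : Fin N → ℝ) (i j : Fin N) : (v j - v i) ^ 2 ≤ spread v :=
  (Finset.single_le_sum (f := fun j => (v j - v i) ^ 2) (fun _ _ => sq_nonneg _)
    (Finset.mem_univ j)).trans
    (Finset.single_le_sum (f := fun i => ∑ j, (v j - v i) ^ 2)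
      (fun _ _ => Finset.sum_nonneg fun _ _ => sq_nonneg _) (Finset.mem_univ i))

theorem adjMatrix_symm (i j : Fin N) : G.adjMatrix ℝ i j = G.adjMatrix ℝ j i := by
  simp only [SimpleGraph.adjMatrix_apply, G.adj_comm]

theorem adjMatrix_mem (i j : Fin N) : 0 ≤ G.adjMatrix ℝ i j ∧ G.adjMatrix ℝ i j ≤ 1 := by
  rw [SimpleGraph.adjMatrix_apply]; split_ifs <;> norm_num

theorem sum_sin_mul_sub (θ u : Fin N → ℝ) :
    ∑ i, ∑ j, G.adjMatrix ℝ i j * Real.sin (θ j - θ i) * (u j - u i) =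
      -2 * ∑ i, u i * phaseField G θ i := by
  have h1 : ∑ i, ∑ j, G.adjMatrix ℝ i j * Real.sin (θ j - θ i) * u i =
      ∑ i, u i * phaseField G θ i := by
    refine Finset.sum_congr rfl fun i _ => ?_
    rw [← Finset.sum_mul, mul_comm]; rfl
  have h2 : ∑ i, ∑ j, G.adjMatrix ℝ i j * Real.sin (θ j - θ i) * u j =
      -∑ i, u i * phaseField G θ i := by
    rw [Finset.sum_comm, ← h1, ← Finset.sum_neg_distrib]
    refine Finset.sum_congr rfl fun i _ => ?_
    rw [← Finset.sum_neg_distrib]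
    refine Finset.sum_congr rfl fun j _ => ?_
    rw [adjMatrix_symm, ← neg_sub (θ j) (θ i), Real.sin_neg]
    ring
  simp only [mul_sub, Finset.sum_sub_distrib, h1, h2]
  ring

theorem dotProduct_phaseJacobian_mulVec (θ v : Fin N → ℝ) :
    v ⬝ᵥ (phaseJacobian G θ).mulVec v =
      -(1 / 2) * ∑ i, ∑ j, G.adjMatrix ℝ i j * Real.cos (θ j - θ i) * (v j - v i) ^ 2 := by
  have h1 : v ⬝ᵥ (phaseJacobian G θ).mulVec v =
      ∑ i, ∑ j, G.adjMatrix ℝ i j * Real.cos (θ j - θ i) * (v j - v i) * v i := by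
    refine Finset.sum_congr rfl fun i _ => ?_
    rw [phaseJacobian_mulVec, Finset.mul_sum]
    exact Finset.sum_congr rfl fun j _ => mul_comm _ _
  have h2 : ∑ i, ∑ j, G.adjMatrix ℝ i j * Real.cos (θ j - θ i) * (v j - v i) * v j =
      -∑ i, ∑ j, G.adjMatrix ℝ i j * Real.cos (θ j - θ i) * (v j - v i) * v i := by
    rw [Finset.sum_comm, ← Finset.sum_neg_distrib]
    refine Finset.sum_congr rfl fun i _ => ?_
    rw [← Finset.sum_neg_distrib]
    refine Finset.sum_congr rfl fun j _ => ?_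
    rw [adjMatrix_symm, ← neg_sub (θ j) (θ i), Real.cos_neg]
    ring
  have h3 : ∑ i, ∑ j, G.adjMatrix ℝ i j * Real.cos (θ j - θ i) * (v j - v i) ^ 2 =
      ∑ i, ∑ j, G.adjMatrix ℝ i j * Real.cos (θ j - θ i) * (v j - v i) * v j -
      ∑ i, ∑ j, G.adjMatrix ℝ i j * Real.cos (θ j - θ i) * (v j - v i) * v i := by
    simp only [← Finset.sum_sub_distrib]
    exact Finset.sum_congr rfl fun i _ => Finset.sum_congr rfl fun j _ => by ring
  rw [h3, h2, h1]; ring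

theorem phaseJacobian_isHermitian (θ : Fin N → ℝ) : (phaseJacobian G θ).IsHermitian := by
  ext i j
  simp only [Matrix.conjTranspose_apply, phaseJacobian, Matrix.of_apply, star_trivial]
  by_cases h : i = j
  · subst h; rfl
  · rw [if_neg h, if_neg (Ne.symm h), adjMatrix_symm, ← neg_sub (θ j) (θ i), Real.cos_neg]

variable {G}

/-- Linear stability makes the Hessian of the energy coercive modulo the constant vectors. -/
theorem IsLinearlyStableEquilibrium.exists_coercive {θ : Fin N → ℝ}
    (h : IsLinearlyStableEquilibrium G θ) :
    ∃ c : ℝ, 0 < c ∧ ∀ v : Fin N → ℝ,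
      c * spread v ≤ ∑ i, ∑ j, G.adjMatrix ℝ i j * Real.cos (θ j - θ i) * (v j - v i) ^ 2 := by
  set A := phaseJacobian G θ with hA
  have hH : A.IsHermitian := phaseJacobian_isHermitian G θ
  obtain ⟨b, hb⟩ : ∃ b : Fin N → Fin N → ℝ, b = fun k => (hH.eigenvectorBasis k).ofLp := ⟨_, rfl⟩
  set μ := hH.eigenvalues
  have heig : ∀ k, A.mulVec (b k) = μ k • b k := fun k => by
    rw [hb]; exact hH.mulVec_eigenvectorBasis k
  have hpars : ∀ u w : Fin N → ℝ, ∑ k, (b k ⬝ᵥ u) * (b k ⬝ᵥ w) = u ⬝ᵥ w := by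
    intro u w
    have := hH.eigenvectorBasis.sum_inner_mul_inner (WithLp.toLp 2 u) (WithLp.toLp 2 w)
    simp only [EuclideanSpace.inner_eq_star_dotProduct, star_trivial] at this
    rw [dotProduct_comm u w, ← this, hb]
    refine Finset.sum_congr rfl fun k _ => ?_
    rw [dotProduct_comm w]
  have horth : ∀ k l, b k ⬝ᵥ b l = if k = l then 1 else 0 := by
    intro k l
    have := orthonormal_iff_ite.1 hH.eigenvectorBasis.orthonormal k l
    simp only [EuclideanSpace.inner_eq_star_dotProduct, star_trivial] at this
    rw [dotProduct_comm, hb]; exact this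
  -- eigenvectors are either constant, with eigenvalue zero, or have a negative eigenvalue
  have hμ : ∀ k, μ k < 0 ∨ (μ k = 0 ∧ ∃ c : ℝ, b k = fun _ => c) := by
    intro k
    by_cases hc : ∃ c : ℝ, b k = fun _ => c
    · right
      refine ⟨?_, hc⟩
      have h1 := dotProduct_phaseJacobian_mulVec G θ (b k)
      rw [← hA, heig, dotProduct_smul, horth, if_pos rfl] at h1
      obtain ⟨c, hc⟩ := hc
      simpa [hc] using h1
    · exact Or.inl (h.2 (μ k) (b k) (heig k) hc)
  have hcoord : ∀ v k, b k ⬝ᵥ A.mulVec v = μ k * (b k ⬝ᵥ v) := by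
    intro v k
    have hT : A.transpose = A := by simpa [Matrix.conjTranspose_eq_transpose_of_trivial] using hH.eq
    rw [Matrix.dotProduct_mulVec, ← Matrix.mulVec_transpose, hT, heig, smul_dotProduct, smul_eq_mul]
  obtain ⟨d, hd0, hd⟩ : ∃ d : ℝ, 0 < d ∧ ∀ k, μ k < 0 → d ≤ -μ k := by
    by_cases hne : ({k | μ k < 0} : Finset (Fin N)).Nonempty
    · obtain ⟨k, hk, hmin⟩ := Finset.exists_min_image _ (fun k => -μ k) hne
      exact ⟨-μ k, by simpa using hk, fun l hl => hmin l (by simpa using hl)⟩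
    · exact ⟨1, one_pos, fun k hk => absurd ⟨k, by simpa using hk⟩ hne⟩
  have hNpos : (0 : ℝ) < 2 * N + 1 := by positivity
  refine ⟨d / (2 * N + 1), by positivity, fun v => ?_⟩
  -- `w` is `v` without its components along the constant eigenvectors
  set w : Fin N → ℝ := v - ∑ k with μ k = 0, (b k ⬝ᵥ v) • b k with hw
  have hwv : spread v = spread w := by
    have hconst : ∀ i j, (∑ k with μ k = 0, (b k ⬝ᵥ v) • b k) i =
        (∑ k with μ k = 0, (b k ⬝ᵥ v) • b k) j := by
      intro i j
      rw [Finset.sum_apply, Finset.sum_apply]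
      refine Finset.sum_congr rfl fun k hk => ?_
      have hk' : μ k = 0 := by simpa using hk
      obtain ⟨c, hc⟩ := ((hμ k).resolve_left (by rw [hk']; exact lt_irrefl _)).2
      simp [hc]
    refine Finset.sum_congr rfl fun i _ => Finset.sum_congr rfl fun j _ => ?_
    rw [hw, Pi.sub_apply, Pi.sub_apply, hconst i j]
    ring
  have hwcoord : ∀ k, b k ⬝ᵥ w = if μ k = 0 then 0 else b k ⬝ᵥ v := by
    intro k
    rw [hw, dotProduct_sub, dotProduct_sum]
    simp only [dotProduct_smul, horth, smul_eq_mul, mul_ite, mul_one, mul_zero]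
    rw [Finset.sum_ite_eq]
    by_cases hk : μ k = 0 <;> simp [hk]
  have hspread : spread w ≤ 2 * N * (w ⬝ᵥ w) := by
    have h1 : ∀ i, ∑ j, (w j - w i) ^ 2 = w ⬝ᵥ w - 2 * w i * ∑ j, w j + N * w i ^ 2 := by
      intro i
      have : ∀ j, (w j - w i) ^ 2 = w j * w j - 2 * w i * w j + w i ^ 2 := fun j => by ring
      simp only [this, Finset.sum_add_distrib, Finset.sum_sub_distrib, ← Finset.mul_sum, dotProduct,
        Finset.sum_const, Finset.card_univ, Fintype.card_fin, nsmul_eq_mul]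
    have h2 : spread w = 2 * N * (w ⬝ᵥ w) - 2 * (∑ j, w j) ^ 2 := by
      simp only [spread, h1, Finset.sum_add_distrib, Finset.sum_sub_distrib, ← Finset.mul_sum,
        ← Finset.sum_mul, dotProduct, Finset.sum_const, Finset.card_univ, Fintype.card_fin,
        nsmul_eq_mul, ← sq]
      ring
    rw [h2]; nlinarith [sq_nonneg (∑ j, w j)]
  have hform : d * (w ⬝ᵥ w) ≤ -(v ⬝ᵥ A.mulVec v) := by
    rw [← hpars w w, ← hpars v (A.mulVec v), Finset.mul_sum, ← Finset.sum_neg_distrib]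
    refine Finset.sum_le_sum fun k _ => ?_
    rw [hwcoord, hcoord]
    by_cases hk : μ k = 0
    · simp [hk]
    · rw [if_neg hk]
      have := hd k ((hμ k).resolve_right fun h => hk h.1)
      nlinarith [mul_self_nonneg (b k ⬝ᵥ v)]
  rw [hA, dotProduct_phaseJacobian_mulVec] at hform
  have hww : 0 ≤ w ⬝ᵥ w := by
    rw [← hpars]; exact Finset.sum_nonneg fun k _ => mul_self_nonneg _
  rw [hwv, div_mul_eq_mul_div, div_le_iff₀ hNpos]
  set Q := ∑ i, ∑ j, G.adjMatrix ℝ i j * Real.cos (θ j - θ i) * (v j - v i) ^ 2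
  calc d * spread w ≤ d * (2 * N * (w ⬝ᵥ w)) := by gcongr
    _ = 2 * (d * (w ⬝ᵥ w)) * N := by ring
    _ ≤ Q * N := by gcongr; linarith
    _ ≤ Q * (2 * N + 1) := by
      have hQ : 0 ≤ Q := by nlinarith
      have : (N : ℝ) ≤ 2 * N + 1 := by linarith [Nat.cast_nonneg (α := ℝ) N]
      gcongr

theorem cos_add_le (d w : ℝ) (hw : |w| ≤ 1) :
    Real.cos (d + w) ≤ Real.cos d - w * Real.sin d - w ^ 2 / 2 * Real.cos d + |w| ^ 3 := by
  have h1 := Real.cos_bound hw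
  have h0 := abs_nonneg w
  have h4 : |w| ^ 4 ≤ |w| ^ 3 := pow_le_pow_of_le_one h0 hw (by norm_num)
  have h3 : 0 ≤ |w| ^ 3 := by positivity
  have h5 : |Real.sin w - w| ≤ |w| ^ 3 / 6 := by
    rw [abs_sub_comm]; exact Real.abs_sub_sin_le w
  have e : Real.cos (d + w) = (Real.cos d - w * Real.sin d - w ^ 2 / 2 * Real.cos d) +
      (Real.cos d * (Real.cos w - (1 - w ^ 2 / 2)) - Real.sin d * (Real.sin w - w)) := by
    rw [Real.cos_add]; ring
  have b1 : Real.cos d * (Real.cos w - (1 - w ^ 2 / 2)) ≤ |w| ^ 4 * (5 / 96) := by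
    refine (le_abs_self _).trans ?_
    rw [abs_mul]
    exact (mul_le_of_le_one_left (abs_nonneg _) (Real.abs_cos_le_one d)).trans h1
  have b2 : -(Real.sin d * (Real.sin w - w)) ≤ |w| ^ 3 / 6 := by
    refine (neg_le_abs _).trans ?_
    rw [abs_mul]
    exact (mul_le_of_le_one_left (abs_nonneg _) (Real.abs_sin_le_one d)).trans h5
  rw [e]
  linarith

/-- Quadratic growth of the energy near a linearly stable equilibrium. -/
theorem phaseEnergy_growth {θ : Fin N → ℝ} (hθ : ∀ i, phaseField G θ i = 0) {c r : ℝ}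
    (hc : ∀ v : Fin N → ℝ,
      c * spread v ≤ ∑ i, ∑ j, G.adjMatrix ℝ i j * Real.cos (θ j - θ i) * (v j - v i) ^ 2)
    (hr0 : 0 ≤ r) (hr1 : r ≤ 1) (hrc : r ≤ c / 4) {v : Fin N → ℝ} (hv : spread v ≤ r ^ 2) :
    phaseEnergy G θ + c / 8 * spread v ≤ phaseEnergy G (θ + v) := by
  have hsmall : ∀ i j, |v j - v i| ≤ r := fun i j =>
    abs_le_of_sq_le_sq ((sq_sub_le_spread v i j).trans hv) hr0
  have hterm : ∀ i j, G.adjMatrix ℝ i j * Real.cos ((θ + v) j - (θ + v) i) ≤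
      G.adjMatrix ℝ i j * Real.cos (θ j - θ i) -
        G.adjMatrix ℝ i j * Real.sin (θ j - θ i) * (v j - v i) -
        1 / 2 * (G.adjMatrix ℝ i j * Real.cos (θ j - θ i) * (v j - v i) ^ 2) +
        r * (v j - v i) ^ 2 := by
    intro i j
    have h1 := cos_add_le (θ j - θ i) (v j - v i) ((hsmall i j).trans hr1)
    have h2 : (θ + v) j - (θ + v) i = θ j - θ i + (v j - v i) := by
      simp only [Pi.add_apply]; ring
    have h3 : |v j - v i| ^ 3 ≤ r * (v j - v i) ^ 2 := by
      rw [← sq_abs (v j - v i), pow_succ']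
      exact mul_le_mul_of_nonneg_right (hsmall i j) (sq_nonneg _)
    obtain ⟨ha0, ha1⟩ := adjMatrix_mem G i j
    have h4 : 0 ≤ r * (v j - v i) ^ 2 := by positivity
    rw [h2]
    have h5 := mul_le_mul_of_nonneg_left (h1.trans (add_le_add_right h3 _)) ha0
    nlinarith [mul_le_mul_of_nonneg_right ha1 h4]
  have hsum := Finset.sum_le_sum fun i (_ : i ∈ Finset.univ) =>
    Finset.sum_le_sum fun j (_ : j ∈ Finset.univ) => hterm i j
  simp only [Finset.sum_add_distrib, Finset.sum_sub_distrib, ← Finset.mul_sum] at hsum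
  rw [sum_sin_mul_sub] at hsum
  simp only [hθ, mul_zero, Finset.sum_const_zero, sub_zero] at hsum
  have hcv := hc v
  have hs := spread_nonneg v
  have hrs := mul_le_mul_of_nonneg_right hrc hs
  change _ ≤ _ + r * spread v at hsum
  unfold phaseEnergy
  linarith

theorem IsSolution.phaseEnergy_le {θ : ℝ → Fin N → ℝ} (hθ : IsSolution G θ) {t : ℝ} (ht : 0 ≤ t) :
    phaseEnergy G (θ t) ≤ phaseEnergy G (θ 0) := by
  have hderiv : ∀ s : ℝ, 0 ≤ s → HasDerivWithinAt (fun s => phaseEnergy G (θ s))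
      (-∑ i, phaseField G (θ s) i * phaseField G (θ s) i) (Set.Ici 0) s := by
    intro s hs
    have h1 : HasDerivWithinAt (fun s => phaseEnergy G (θ s))
        (-(1 / 2) * ∑ i, ∑ j, G.adjMatrix ℝ i j * (-Real.sin (θ s j - θ s i) *
          (phaseField G (θ s) j - phaseField G (θ s) i))) (Set.Ici 0) s := by
      refine HasDerivWithinAt.const_mul _ ?_
      refine HasDerivWithinAt.fun_sum fun i _ => HasDerivWithinAt.fun_sum fun j _ => ?_
      exact (((hθ s hs j).sub (hθ s hs i)).cos).const_mul _
    convert h1 using 1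
    have h2 := sum_sin_mul_sub G (θ s) (phaseField G (θ s))
    have h3 : ∑ i, ∑ j, G.adjMatrix ℝ i j * (-Real.sin (θ s j - θ s i) *
          (phaseField G (θ s) j - phaseField G (θ s) i)) =
        -∑ i, ∑ j, G.adjMatrix ℝ i j * Real.sin (θ s j - θ s i) *
          (phaseField G (θ s) j - phaseField G (θ s) i) := by
      simp only [← Finset.sum_neg_distrib]
      exact Finset.sum_congr rfl fun i _ => Finset.sum_congr rfl fun j _ => by ring
    rw [h3, h2]; ring
  have hanti : AntitoneOn (fun s => phaseEnergy G (θ s)) (Set.Ici 0) := by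
    refine antitoneOn_of_hasDerivWithinAt_nonpos (convex_Ici 0)
      (fun s hs => (hderiv s hs).continuousWithinAt)
      (fun s hs => (hderiv s (interior_subset hs)).mono interior_subset) fun s _ => ?_
    exact neg_nonpos.2 (Finset.sum_nonneg fun i _ => mul_self_nonneg _)
  exact hanti (Set.mem_Ici.2 le_rfl) ht ht

/-- Solutions that start near a strict local minimum of the energy, at low energy, stay near it. -/
theorem IsSolution.spread_lt {θ₀ : Fin N → ℝ} {r e : ℝ}
    (hgrow : ∀ v : Fin N → ℝ, spread v = r ^ 2 → e ≤ phaseEnergy G (θ₀ + v))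
    {θ : ℝ → Fin N → ℝ} (hθ : IsSolution G θ) (h0 : spread (θ 0 - θ₀) < r ^ 2)
    (hE : phaseEnergy G (θ 0) < e) {t : ℝ} (ht : 0 ≤ t) : spread (θ t - θ₀) < r ^ 2 := by
  by_contra hlt
  have hcont : ContinuousOn (fun s => spread (θ s - θ₀)) (Set.Icc 0 t) := by
    have hc : ∀ i, ContinuousOn (fun s => θ s i) (Set.Icc 0 t) := fun i s hs =>
      (hθ s hs.1 i).continuousWithinAt.mono Set.Icc_subset_Ici_self
    unfold spread
    simp only [Pi.sub_apply]
    fun_prop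
  obtain ⟨s, hs, hsr⟩ := intermediate_value_Icc ht hcont ⟨h0.le, not_lt.1 hlt⟩
  have h1 := hgrow (θ s - θ₀) hsr
  rw [add_sub_cancel] at h1
  exact absurd (h1.trans (hθ.phaseEnergy_le hs.1)) (not_le.2 hE)

theorem continuous_phaseEnergy : Continuous (phaseEnergy G) := by
  unfold phaseEnergy; fun_prop

theorem continuous_spread : Continuous (spread : (Fin N → ℝ) → ℝ) := by
  unfold spread; fun_prop

/-- The radius of the trapping region is chosen so small that the phase difference of two oscillators
with `θ₀ i ≠ θ₀ j` modulo `2π` stays away from zero. -/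
theorem not_globallySynchronizing_of_isLinearlyStableEquilibrium {θ₀ : Fin N → ℝ}
    (h : IsLinearlyStableEquilibrium G θ₀) (hphase : ¬ IsInPhase θ₀) :
    ¬ GloballySynchronizing G := by
  intro hsync
  obtain ⟨c, hc0, hc⟩ := h.exists_coercive
  obtain ⟨i, j, hij⟩ : ∃ i j, (θ₀ i : Real.Angle) ≠ θ₀ j := by
    simpa [IsInPhase] using hphase
  have hcos : Real.cos (θ₀ i - θ₀ j) < 1 := by
    refine lt_of_le_of_ne (Real.cos_le_one _) fun h1 => hij ?_
    obtain ⟨z, hz⟩ := (Real.cos_eq_one_iff _).1 h1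
    exact Real.Angle.angle_eq_iff_two_pi_dvd_sub.2 ⟨z, by rw [← hz]; ring⟩
  obtain ⟨r, hr0, hr1, hrc, hrd⟩ : ∃ r : ℝ, 0 < r ∧ r ≤ 1 ∧ r ≤ c / 4 ∧
      r ≤ (1 - Real.cos (θ₀ i - θ₀ j)) / 2 :=
    ⟨min 1 (min (c / 4) ((1 - Real.cos (θ₀ i - θ₀ j)) / 2)),
      lt_min one_pos (lt_min (by positivity) (by linarith)), min_le_left _ _,
      (min_le_right _ _).trans (min_le_left _ _), (min_le_right _ _).trans (min_le_right _ _)⟩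
  set e := phaseEnergy G θ₀ + c / 8 * r ^ 2 with he
  have hopen : IsOpen {ψ : Fin N → ℝ | spread (ψ - θ₀) < r ^ 2 ∧ phaseEnergy G ψ < e} :=
    (isOpen_lt (continuous_spread.comp (continuous_id.sub continuous_const)) continuous_const).inter
      (isOpen_lt continuous_phaseEnergy continuous_const)
  obtain ⟨ψ, ⟨hψ1, hψ2⟩, θ, rfl, hθ, hconv⟩ :=
    (Measure.dense_of_ae hsync).inter_open_nonempty _ hopen ⟨θ₀, by
      have h1 : 0 < c / 8 * r ^ 2 := by positivity
      have h2 : spread (θ₀ - θ₀) = 0 := by simp [spread]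
      exact ⟨by rw [h2]; positivity, by linarith⟩⟩
  have hnear : ∀ t : ℝ, 0 ≤ t → spread (θ t - θ₀) < r ^ 2 := fun t ht =>
    hθ.spread_lt (fun v hv => by
      have := phaseEnergy_growth h.1 hc hr0.le hr1 hrc hv.le
      rwa [hv] at this) hψ1 hψ2 ht
  have hlim : Tendsto (fun t => Real.cos (θ t i - θ t j)) atTop (𝓝 1) := by
    have := (Real.Angle.continuous_cos.tendsto 0).comp (hconv i j)
    rw [Real.Angle.cos_zero] at this
    exact this
  have hle : 1 ≤ (1 + Real.cos (θ₀ i - θ₀ j)) / 2 := by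
    refine le_of_tendsto hlim ?_
    filter_upwards [eventually_ge_atTop 0] with t ht
    have h1 := (sq_sub_le_spread (θ t - θ₀) j i).trans (hnear t ht).le
    have h2 := abs_le_of_sq_le_sq h1 hr0.le
    have h3 := abs_cos_sub_cos_le (θ t i - θ t j) (θ₀ i - θ₀ j)
    have h4 : θ t i - θ t j - (θ₀ i - θ₀ j) = (θ t - θ₀) i - (θ t - θ₀) j := by
      simp only [Pi.sub_apply]; ring
    rw [h4] at h3
    linarith [le_abs_self (Real.cos (θ t i - θ t j) - Real.cos (θ₀ i - θ₀ j))]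
  linarith

theorem connectivity_le_one (hN : 2 ≤ N) (G : SimpleGraph (Fin N)) : connectivity G ≤ 1 := by
  have h2 : (2 : ℝ) ≤ N := by exact_mod_cast hN
  have h1 : ((G.minDegree : ℕ) : ℝ) + 1 ≤ N := by
    have := (G.minDegree_le_degree ⟨0, by omega⟩).trans_lt (G.degree_lt_card_verts _)
    rw [Fintype.card_fin] at this
    exact_mod_cast this
  rw [connectivity, div_le_one (by linarith)]
  linarith

end Energy

/-! ### The lower bound on the critical connectivity -/

theorem supMu_le_criticalConnectivity : supMu ≤ criticalConnectivity := by
  refine le_csInf ⟨2, fun N hN G hG => ?_⟩ fun c hc => ?_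
  -- the set of thresholds is nonempty: no network has connectivity at least `2`
  · linarith [connectivity_le_one hN G]
  · by_contra hlt
    obtain ⟨N, hN, G, θ, hG, hstable, hphase⟩ := exists_network_of_lt_supMu (not_le.1 hlt)
    exact not_globallySynchronizing_of_isLinearlyStableEquilibrium hstable hphase
      (hc N hN G hG.le)

theorem theorem2 :
    -- the supremum of all `μ^{(N,p)}`, over the `(N, p)` for which it exists, and its value
    IsLUB {μ : ℝ | ∃ N p : ℕ, 2 ≤ N ∧ 1 ≤ p ∧ p ≤ N / 2 ∧ IsMaxConnectivity N p μ} supMu ∧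
    0.683875 ≤ supMu ∧ supMu < 0.683876 ∧
    -- `μ^{(19m,m)}` exists for all `m ≥ 1` and converges to the supremum
    (∃ u : ℕ → ℝ, (∀ m : ℕ, 1 ≤ m → IsMaxConnectivity (19 * m) m (u m)) ∧
      Tendsto u atTop (𝓝 supMu)) ∧
    -- below the supremum there are networks with a stable state that is not in-phase
    (∀ c : ℝ, c < supMu → ∃ (N : ℕ) (_ : 2 ≤ N) (G : SimpleGraph (Fin N)) (θ : Fin N → ℝ),
      c < connectivity G ∧ IsLinearlyStableEquilibrium G θ ∧ ¬ IsInPhase θ) ∧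
    -- the resulting lower bound on the critical connectivity
    supMu ≤ criticalConnectivity :=
  ⟨isLUB_supMu, supMu_bounds.1, supMu_bounds.2, exists_maxConnectivity_seq,
    fun _ hc => exists_network_of_lt_supMu hc, supMu_le_criticalConnectivity⟩
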